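/- Let $N\ge 2$, $p>1$, $\gamma>p$, $q\ge 1$ with $q>N/\gamma$, let $\nu,c_H>0$, and let $\Omega\subset\mathbb{R}^N$ be a bounded open set. For measurable $h:\Omega\to\mathbb{R}$ put $$\|h\|_{\mathcal{L}^{1,N/q}(\Omega)}=\sup_{z\in\Omega,\;0<r\le \mathrm{diam}(\Omega)} r^{\frac Nq-N}\int_{B_r(z)\cap\Omega}|h|\,dx ,$$ and let the Morrey space $\mathcal{L}^{1,N/q}(\Omega)$ consist of those $h\in L^1(\Omega)$ for which this is finite. Let $\mathcal{A}:\Omega\times\mathbb{R}\times\mathbb{R}^N\to\mathbb{R}^N$ be a Carathéodory function (measurable in $x$, continuous in the remaining variables) and $\mathcal{B}:\Omega\times\mathbb{R}\times\mathbb{R}^N\to\mathbb{R}$ a function such that, for a.e. $x\in\Omega$ and all $(s,\xi)\in\mathbb{R}\times\mathbb{R}^N$, $$|\mathcal{A}(x,s,\xi)|\le\nu|\xi|^{p-1},\qquad \mathcal{B}(x,s,\xi)\ge c_H|\xi|^\gamma-\lambda s-f(x),$$ where $\lambda\ge0$ and $f\in\mathcal{L}^{1,N/q}(\Omega)$. Let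 $u\in W^{1,\gamma}_{\mathrm{loc}}(\Omega)$ satisfy $\lambda u^+\in\mathcal{L}^{1,N/q}(\Omega)$, where $u^+=\max\{u,0\}$, and let $u$ be a distributional supersolution of $$-\mathrm{div}(\mathcal{A}(x,u,\nabla u))\ge\mathcal{B}(x,u,\nabla u)\quad\text{in }\Omega,$$ that is, $\mathcal{A}(\cdot,u,\nabla u)\in L^{p/(p-1)}_{\mathrm{loc}}(\Omega)$, $\mathcal{B}(\cdot,u,\nabla u)\in L^1_{\mathrm{loc}}(\Omega)$ and $$\int_\Omega\mathcal{A}(x,u,\nabla u)\cdot\nabla\varphi\,dx\ge\int_\Omega\mathcal{B}(x,u,\nabla u)\,\varphi\,dx$$ for all $0\le\varphi\in C^1(\Omega)$ with compact support in $\Omega$. Then $u$ coincides a.e. in $\Omega$ with a function, still denoted by $u$, that is locally Hölder continuous in $\Omega$ with exponent $$\alpha=\min\left\{1-\frac{N}{q\gamma},\ \frac{\gamma-p}{\gamma-(p-1)}\right\}\in(0,1),$$ and there is a constant $K$ such that for every ball $B\subset\Omega$ $$|u(x)-u(y)|\le K|x-y|^\alpha\qquad\text{for all }x,y\in B.$$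 The constant $K$ depends only on $p,q,\gamma,N,\nu,c_H,\Omega$ and on upper bounds for $\|f\|_{\mathcal{L}^{1,N/q}(\Omega)}$ and $\|\lambda u^+\|_{\mathcal{L}^{1,N/q}(\Omega)}$; in particular it does not depend on the ball $B$. -/

import Mathlib

open MeasureTheory Set Filter Topology
open scoped NNReal ENNReal ContDiff

namespace GradientInequality

noncomputable section

/-- The Euclidean space `ℝ^N`. -/
abbrev Eucl (N : ℕ) : Type := EuclideanSpace ℝ (Fin N)

/-- `h ∈ L^r_loc(Ω)`: `h` is in `L^r(K)` for every compact subset `K` of `Ω`. -/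
def MemLpLoc {N : ℕ} {F : Type*} [NormedAddCommGroup F] (r : ℝ) (Ω : Set (Eucl N))
    (h : Eucl N → F) : Prop :=
  ∀ K : Set (Eucl N), IsCompact K → K ⊆ Ω → MemLp h (ENNReal.ofReal r) (volume.restrict K)

/-- `Du` is a weak (distributional) gradient of `u` in `Ω`:
`∫_Ω u ∇φ = - ∫_Ω φ Du` for all `φ ∈ C^∞_c(Ω)`. -/
def IsWeakGradient {N : ℕ} (Ω : Set (Eucl N)) (u : Eucl N → ℝ) (Du : Eucl N → Eucl N) : Prop :=
  ∀ φ : Eucl N → ℝ, ContDiff ℝ ∞ φ → HasCompactSupport φ → tsupport φ ⊆ Ω →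
    ∫ x in Ω, u x • gradient φ x = - ∫ x in Ω, φ x • Du x

/-- `u ∈ W^{1,r}_loc(Ω)` with weak gradient `Du`. -/
structure MemW1Loc {N : ℕ} (r : ℝ) (Ω : Set (Eucl N)) (u : Eucl N → ℝ)
    (Du : Eucl N → Eucl N) : Prop where
  memLpLoc : MemLpLoc r Ω u
  memLpLoc_gradient : MemLpLoc r Ω Du
  isWeakGradient : IsWeakGradient Ω u Du

/-- `A : Ω × ℝ × ℝ^N → ℝ^N` is a Carathéodory function: (Lebesgue) measurable in `x ∈ Ω` and
continuous in the pair of the other two variables. -/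
structure IsCaratheodory {N : ℕ} (Ω : Set (Eucl N)) (A : Eucl N → ℝ → Eucl N → Eucl N) :
    Prop where
  aemeasurable : ∀ (s : ℝ) (ξ : Eucl N), AEMeasurable (fun x => A x s ξ) (volume.restrict Ω)
  continuous : ∀ᵐ x ∂(volume.restrict Ω), Continuous fun z : ℝ × Eucl N => A x z.1 z.2

/-- The growth condition `|A(x,s,ξ)| ≤ ν |ξ|^{p-1}` for a.e. `x ∈ Ω` and all `(s,ξ)`. -/
def GrowthA {N : ℕ} (p ν : ℝ) (Ω : Set (Eucl N)) (A : Eucl N → ℝ → Eucl N → Eucl N) : Prop :=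
  ∀ᵐ x ∂(volume.restrict Ω), ∀ (s : ℝ) (ξ : Eucl N), ‖A x s ξ‖ ≤ ν * ‖ξ‖ ^ (p - 1)

/-- The lower bound `B(x,s,ξ) ≥ c_H |ξ|^γ - λ s - f(x)` for a.e. `x ∈ Ω` and all `(s,ξ)`. -/
def LowerBoundB {N : ℕ} (γ cH lam : ℝ) (f : Eucl N → ℝ) (Ω : Set (Eucl N))
    (B : Eucl N → ℝ → Eucl N → ℝ) : Prop :=
  ∀ᵐ x ∂(volume.restrict Ω), ∀ (s : ℝ) (ξ : Eucl N),
    cH * ‖ξ‖ ^ γ - lam * s - f x ≤ B x s ξ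

/-- `u`, with weak gradient `Du`, is a distributional supersolution of
`-div A(x,u,∇u) ≥ B(x,u,∇u)` in `Ω`: `u ∈ W^{1,p}_loc(Ω)`, `A(·,u,∇u) ∈ L^{p'}_loc(Ω)`,
`B(·,u,∇u) ∈ L^1_loc(Ω)` and the inequality holds against all nonnegative `φ ∈ C^1_c(Ω)`. -/
structure IsDistribSupersolution {N : ℕ} (p : ℝ) (Ω : Set (Eucl N))
    (A : Eucl N → ℝ → Eucl N → Eucl N) (B : Eucl N → ℝ → Eucl N → ℝ)
    (u : Eucl N → ℝ) (Du : Eucl N → Eucl N) : Prop where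
  memW1Loc : MemW1Loc p Ω u Du
  memLpLoc_A : MemLpLoc (p / (p - 1)) Ω fun x => A x (u x) (Du x)
  memLpLoc_B : MemLpLoc 1 Ω fun x => B x (u x) (Du x)
  inequality : ∀ φ : Eucl N → ℝ, ContDiff ℝ 1 φ → HasCompactSupport φ → tsupport φ ⊆ Ω →
    (∀ x, 0 ≤ φ x) →
    ∫ x in Ω, B x (u x) (Du x) * φ x ≤ ∫ x in Ω, inner ℝ (A x (u x) (Du x)) (gradient φ x)

/-- The Morrey norm
`‖h‖ = sup { r^{(θ-N)/s} ‖h‖_{L^s(B_r(z) ∩ Ω)} : z ∈ Ω, 0 < r ≤ diam Ω }`, as an extended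
nonnegative number. -/
def morreyNorm {N : ℕ} (s θ : ℝ) (Ω : Set (Eucl N)) (h : Eucl N → ℝ) : ℝ≥0∞ :=
  ⨆ (z : Eucl N) (_ : z ∈ Ω) (r : ℝ) (_ : 0 < r) (_ : ENNReal.ofReal r ≤ Metric.ediam Ω),
    ENNReal.ofReal (r ^ ((θ - N) / s)) *
      eLpNorm h (ENNReal.ofReal s) (volume.restrict (Metric.ball z r ∩ Ω))

/-- The Morrey space `𝓛^{s,θ}(Ω)`: functions in `L^s(Ω)` with finite Morrey norm. -/
def MemMorrey {N : ℕ} (s θ : ℝ) (Ω : Set (Eucl N)) (h : Eucl N → ℝ) : Prop :=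
  MemLp h (ENNReal.ofReal s) (volume.restrict Ω) ∧ morreyNorm s θ Ω h < ⊤

/-- `v` is locally Hölder continuous in `Ω` with exponent `α ∈ (0,1]`: it is `α`-Hölder
continuous on every compact subset of `Ω`. -/
def IsLocallyHolder {N : ℕ} (α : ℝ) (Ω : Set (Eucl N)) (v : Eucl N → ℝ) : Prop :=
  0 < α ∧ α ≤ 1 ∧ ∀ K : Set (Eucl N), IsCompact K → K ⊆ Ω →
    ∃ C : ℝ, ∀ x ∈ K, ∀ y ∈ K, |v x - v y| ≤ C * ‖x - y‖ ^ α

/-- The Hölder exponent `min {1 - N/(qγ), (γ-p)/(γ-(p-1))}`. -/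
def holderExponent (N : ℕ) (p q γ : ℝ) : ℝ :=
  min (1 - N / (q * γ)) ((γ - p) / (γ - (p - 1)))

end

end GradientInequality

namespace GradientInequality

noncomputable section

variable {N : ℕ}

/-! The superlinear gradient term forces a Morrey bound on `Du`, and Morrey's Dirichlet growth
argument turns that bound into Hölder continuity. Testing the inequality with a high power of a
cutoff between `B_r` and `B_{2r}` produces the good term `cH |Du|^γ` and a flux term of size `ν
|Du|^{p-1} / r`. Since `γ > p - 1`, Young's inequality absorbs the flux into half of the good term
at the price of `r^{-g}`, with `g = γ / (γ - (p - 1))`. The zero order data are controlled by their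
Morrey norms, so `∫_{B_r} |Du|^γ` is bounded by a constant times `r^{N - N/q} + r^{N - g}`
(`IsDistribSupersolution.integral_gradient_rpow_le`). The exponent `α` is the largest one for which
both powers are at most a constant times `r^{N - γ + γ α}`. Passing from `|Du|^γ` to `|Du|` gives
`∫_{B_r} |Du| ≤ C₀ r^{N - 1 + α}` whenever `B_{3r} ⊆ Ω` (`exists_hasMorreyGrowth`). For the
continuity, weighted averages of `u` are followed while their centre and radius vary. The derivative
of such an average is an integral of `Du` against a field of size `r^{-N}` supported in the ball of
radius `r`, hence at most a constant times `r^{α - 1}`, which is integrable at zero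
(`hasDerivAt_mollify`, `norm_integral_inner_dilate_le`). The limits of the averages define the
representative. To reach the boundary of a ball with a uniform constant, the averaging centres slide
towards the centre of the ball as the radius grows (`abs_preciseRep_sub_le`). -/

/-! ### Integration by parts against vector fields -/

theorem integrable_smul_of_isCompact {F : Type*} [NormedAddCommGroup F] [NormedSpace ℝ F]
    {K : Set (Eucl N)} {h : Eucl N → F} {g : Eucl N → ℝ} (hK : IsCompact K)
    (hh : IntegrableOn h K) (hg : Continuous g) (h0 : ∀ x ∉ K, g x = 0) :
    Integrable (fun x => g x • h x) := by
  rw [← integrableOn_iff_integrable_of_support_subset (s := K)]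
  · exact hh.continuousOn_smul hg.continuousOn hK
  · intro x hx
    by_contra hxK
    exact hx (by simp [h0 x hxK])

theorem MemLpLoc.integrableOn {F : Type*} [NormedAddCommGroup F] {r : ℝ} (hr : 1 ≤ r)
    {Ω K : Set (Eucl N)} {h : Eucl N → F} (hh : MemLpLoc r Ω h) (hK : IsCompact K) (hKΩ : K ⊆ Ω) :
    IntegrableOn h K := by
  have : IsFiniteMeasure (volume.restrict K) := ⟨by simpa using hK.measure_lt_top⟩
  exact (hh K hK hKΩ).integrable (by simpa using ENNReal.ofReal_le_ofReal hr)

theorem gradient_apply_eq (φ : Eucl N → ℝ) (x : Eucl N) (i : Fin N) :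
    gradient φ x i = fderiv ℝ φ x (EuclideanSpace.single i 1) := by
  rw [← inner_gradient_left, EuclideanSpace.inner_single_right]
  simp

/-- Integration by parts against a compactly supported vector field. -/
theorem IsWeakGradient.integral_divergence {Ω : Set (Eucl N)} {u : Eucl N → ℝ}
    {Du : Eucl N → Eucl N} (h : IsWeakGradient Ω u Du) {K : Set (Eucl N)} (hK : IsCompact K)
    (hKΩ : K ⊆ Ω) (hu : IntegrableOn u K) (hDu : IntegrableOn Du K) {Φ : Eucl N → Eucl N}
    (hΦ : ContDiff ℝ ∞ Φ) (hΦK : tsupport Φ ⊆ K) :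
    ∫ x, u x * ∑ i, (fderiv ℝ Φ x (EuclideanSpace.single i 1)) i
      = -∫ x, inner ℝ (Du x) (Φ x) := by
  have hc : HasCompactSupport Φ := hK.of_isClosed_subset (isClosed_tsupport _) hΦK
  have hΦ0 : ∀ x ∉ K, Φ x = 0 := fun x hx => image_eq_zero_of_notMem_tsupport fun h => hx (hΦK h)
  have hΦ1 : ∀ x ∉ K, fderiv ℝ Φ x = 0 := fun x hx => image_eq_zero_of_notMem_tsupport
    fun h => hx (hΦK (tsupport_fderiv_subset ℝ h))
  have hd : ∀ x, DifferentiableAt ℝ Φ x := hΦ.differentiable (by simp)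
  have hφs : ∀ i, ContDiff ℝ ∞ fun x => Φ x i := fun i =>
    (EuclideanSpace.proj (𝕜 := ℝ) i).contDiff.comp hΦ
  have hfd : ∀ i x v, fderiv ℝ (fun x => Φ x i) x v = (fderiv ℝ Φ x v) i := by
    intro i x v
    have := ((EuclideanSpace.proj (𝕜 := ℝ) i).hasFDerivAt.comp x (hd x).hasFDerivAt).fderiv
    change fderiv ℝ (fun x => Φ x i) x = _ at this
    rw [this]; rfl
  have hgc : ∀ i, Continuous fun x => (fderiv ℝ Φ x (EuclideanSpace.single i 1)) i := by
    intro i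
    have := hΦ.continuous_fderiv (by simp)
    fun_prop
  have hi1 : ∀ i, Integrable fun x => u x * (fderiv ℝ Φ x (EuclideanSpace.single i 1)) i := by
    intro i
    have := integrable_smul_of_isCompact hK hu (hgc i) (by intro x hx; simp [hΦ1 x hx])
    simpa [mul_comm] using this
  have hi2 : ∀ i, Integrable fun x => Φ x i • Du x := fun i =>
    integrable_smul_of_isCompact hK hDu (hφs i).continuous (by intro x hx; simp [hΦ0 x hx])
  -- The weak gradient identity is vector valued: testing it with the `i`-th component of `Φ` and
  -- keeping only its `i`-th coordinate gives one term of the divergence.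
  have key : ∀ i, ∫ x, u x * (fderiv ℝ Φ x (EuclideanSpace.single i 1)) i
      = - ∫ x, Φ x i * Du x i := by
    intro i
    have hts : tsupport (fun x => Φ x i) ⊆ K := by
      refine (closure_mono ?_).trans hΦK
      intro x hx h0
      exact hx (by simp [h0])
    have h1 := h (fun x => Φ x i) (hφs i) (hK.of_isClosed_subset (isClosed_tsupport _) hts)
      (hts.trans hKΩ)
    have hz : ∀ x ∉ Ω, u x • gradient (fun x => Φ x i) x = 0 := by
      intro x hx
      have : gradient (fun x => Φ x i) x = 0 := by
        ext j
        rw [gradient_apply_eq, hfd, hΦ1 x (fun h => hx (hKΩ h))]; simp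
      simp [this]
    rw [setIntegral_eq_integral_of_forall_compl_eq_zero hz,
      setIntegral_eq_integral_of_forall_compl_eq_zero
        (by intro x hx; simp [hΦ0 x (fun h => hx (hKΩ h))])] at h1
    have hgi : Integrable fun x => u x • gradient (fun x => Φ x i) x := by
      have hgrc : Continuous (gradient fun x => Φ x i) := by
        have := (hφs i).continuous_fderiv (by simp)
        unfold gradient
        fun_prop
      have h2 : IntegrableOn (fun x => u x • gradient (fun x => Φ x i) x) K :=
        hu.smul_continuousOn hgrc.continuousOn hK
      rwa [integrableOn_iff_integrable_of_support_subset] at h2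
      intro x hx
      by_contra hxK
      refine hx ?_
      have : gradient (fun x => Φ x i) x = 0 := by
        ext j
        rw [gradient_apply_eq, hfd, hΦ1 x hxK]; simp
      simp [this]
    have h3 := congrArg (EuclideanSpace.proj (𝕜 := ℝ) i) h1
    rw [map_neg, ← ContinuousLinearMap.integral_comp_comm _ hgi,
      ← ContinuousLinearMap.integral_comp_comm _ (hi2 i)] at h3
    simpa [gradient_apply_eq, hfd] using h3
  simp_rw [Finset.mul_sum]
  rw [integral_finsetSum _ fun i _ => hi1 i]
  simp_rw [key]
  rw [Finset.sum_neg_distrib, ← integral_finsetSum]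
  · congr 2
  · intro i _
    simpa using (EuclideanSpace.proj (𝕜 := ℝ) i).integrable_comp (hi2 i)

/-! ### Rescaled kernels and their transport identity -/

/-- The kernel `w ↦ r^{-N} ρ((x - w) / r)`. -/
def dilate (ρ : Eucl N → ℝ) (x : Eucl N) (r : ℝ) (w : Eucl N) : ℝ :=
  (r ^ N)⁻¹ * ρ (r⁻¹ • (x - w))

/-- The average of `u` around `x` at scale `r`, with weight `ρ`. -/
def mollify (ρ u : Eucl N → ℝ) (x : Eucl N) (r : ℝ) : ℝ := ∫ w, u w * dilate ρ x r w

theorem dilate_eq_zero {ρ : Eucl N → ℝ} (hρ : ∀ y, 1 ≤ ‖y‖ → ρ y = 0) {x w : Eucl N} {r : ℝ}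
    (hr : 0 < r) (hw : r ≤ dist w x) : dilate ρ x r w = 0 := by
  unfold dilate
  rw [hρ, mul_zero]
  rw [norm_smul, norm_inv, Real.norm_of_nonneg hr.le, ← dist_eq_norm, dist_comm, inv_mul_eq_div]
  exact (one_le_div hr).2 hw

/-- The derivative of `t ↦ dilate ρ (a + t e) (c + t κ) w`. -/
def dilateDeriv (ρ : Eucl N → ℝ) (x : Eucl N) (r : ℝ) (e : Eucl N) (κ : ℝ) (w : Eucl N) : ℝ :=
  (r ^ N)⁻¹ * r⁻¹ * (fderiv ℝ ρ (r⁻¹ • (x - w)) (e - κ • (r⁻¹ • (x - w)))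
    - N * κ * ρ (r⁻¹ • (x - w)))

theorem hasDerivAt_dilate {ρ : Eucl N → ℝ} (hρ : ContDiff ℝ ∞ ρ) (a e w : Eucl N) (c κ t : ℝ)
    (hr : 0 < c + t * κ) :
    HasDerivAt (fun t : ℝ => dilate ρ (a + t • e) (c + t * κ) w)
      (dilateDeriv ρ (a + t • e) (c + t * κ) e κ w) t := by
  have hr0 := hr.ne'
  have hrd : HasDerivAt (fun t : ℝ => c + t * κ) κ t := by
    simpa using ((hasDerivAt_id t).mul_const κ).const_add c
  have hxd : HasDerivAt (fun t : ℝ => a + t • e - w) e t := by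
    simpa using (((hasDerivAt_id t).smul_const e).const_add a).sub_const w
  have hy : HasDerivAt (fun t : ℝ => (c + t * κ)⁻¹ • (a + t • e - w))
      ((c + t * κ)⁻¹ • (e - κ • ((c + t * κ)⁻¹ • (a + t • e - w)))) t := by
    refine ((hrd.fun_inv hr0).fun_smul hxd).congr_deriv ?_
    generalize a + t • e - w = y
    rw [smul_sub, smul_smul, smul_smul, sub_eq_add_neg, ← neg_smul]
    congr 2
    field_simp
  have hρy := ((hρ.differentiable (by simp)) _).hasFDerivAt.comp_hasDerivAt t hy
  refine (((hrd.fun_pow N).fun_inv (pow_ne_zero N hr0)).fun_mul hρy).congr_deriv ?_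
  simp only [dilateDeriv, Function.comp_apply, map_smul, smul_eq_mul]
  generalize fderiv ℝ ρ ((c + t * κ)⁻¹ • (a + t • e - w)) _ = D
  generalize ρ _ = R
  generalize c + t * κ = r at hr0
  rcases Nat.eq_zero_or_pos N with h | h
  · simp [h]
  · obtain ⟨n, hn⟩ : ∃ n, N = n + 1 := ⟨N - 1, by omega⟩
    simp only [hn, Nat.add_sub_cancel]
    field_simp
    ring

/-- This is the continuity equation for the kernel. The point `w = x - r y` with `y` fixed moves
with velocity `e - κ y` when `x` and `r` have velocities `e` and `κ`, and the kernel is a density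
carried along by this motion, so its time derivative is minus the divergence of density times
velocity. -/
theorem divergence_dilate {ρ : Eucl N → ℝ} (hρ : ContDiff ℝ ∞ ρ) (x e w : Eucl N) (r κ : ℝ) :
    ∑ i, (fderiv ℝ (fun w => -(dilate ρ x r w • (e - κ • (r⁻¹ • (x - w))))) w
      (EuclideanSpace.single i 1)) i = dilateDeriv ρ x r e κ w := by
  have hy : HasFDerivAt (fun w : Eucl N => r⁻¹ • (x - w))
      (-(r⁻¹ • ContinuousLinearMap.id ℝ (Eucl N))) w := by
    simpa using ((hasFDerivAt_id (𝕜 := ℝ) w).const_sub x).fun_const_smul r⁻¹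
  have hρy := ((hρ.differentiable (by simp)) (r⁻¹ • (x - w))).hasFDerivAt.comp w hy
  have h1 := hρy.const_mul (r ^ N)⁻¹
  have h2 := (h1.smul ((hy.const_smul κ).const_sub e)).neg
  have h3 := h2.fderiv
  change fderiv ℝ (fun w => -(dilate ρ x r w • (e - κ • (r⁻¹ • (x - w))))) w = _ at h3
  rw [h3]
  simp only [dilateDeriv]
  set y := r⁻¹ • (x - w)
  set L := fderiv ℝ ρ y
  have hL : ∀ v : Eucl N, L v = ∑ i, L (EuclideanSpace.single i 1) * v i := by
    intro v
    conv_lhs => rw [← (EuclideanSpace.basisFun (Fin N) ℝ).sum_repr v]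
    simp [mul_comm]
  -- The term with factor `N` comes from the divergence of `y`; writing `N` as a sum of ones allows
  -- a comparison coordinate by coordinate.
  have hN : (N : ℝ) = ∑ i : Fin N, (1 : ℝ) := by simp
  rw [hL (e - κ • y), hN, Finset.sum_mul, Finset.sum_mul, ← Finset.sum_sub_distrib, Finset.mul_sum]
  refine Finset.sum_congr rfl fun i _ => ?_
  simp [y]
  ring

/-- `ρ` is a smooth weight of mass one that vanishes off the unit ball and is bounded by `S`. -/
structure IsMollifier (ρ : Eucl N → ℝ) (S : ℝ) : Prop where
  contDiff : ContDiff ℝ ∞ ρ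
  eq_zero : ∀ y, 1 ≤ ‖y‖ → ρ y = 0
  abs_le : ∀ y, |ρ y| ≤ S
  integral_eq_one : ∫ y, ρ y = 1

theorem exists_isMollifier (N : ℕ) : ∃ (ρ : Eucl N → ℝ) (S : ℝ), IsMollifier ρ S := by
  let φ : ContDiffBump (0 : Eucl N) := ⟨1 / 2, 1, by norm_num, by norm_num⟩
  obtain ⟨S, hS⟩ := (φ.hasCompactSupport_normed (μ := volume)).exists_bound_of_continuous
    φ.continuous_normed
  refine ⟨φ.normed volume, S, φ.contDiff_normed, fun y hy => ?_, hS, φ.integral_normed⟩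
  rw [← Function.notMem_support, φ.support_normed_eq]
  simpa [φ] using hy

namespace IsMollifier

variable {ρ : Eucl N → ℝ} {S : ℝ}

theorem nonneg (h : IsMollifier ρ S) : 0 ≤ S := (abs_nonneg _).trans (h.abs_le 0)

theorem fderiv_eq_zero (h : IsMollifier ρ S) {y : Eucl N} (hy : 1 < ‖y‖) : fderiv ℝ ρ y = 0 := by
  have : ρ =ᶠ[𝓝 y] fun _ => 0 := by
    filter_upwards [continuous_norm.continuousAt.eventually (lt_mem_nhds hy)] with z hz
    exact h.eq_zero z (le_of_lt hz)
  rw [this.fderiv_eq]; simp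

theorem hasCompactSupport (h : IsMollifier ρ S) : HasCompactSupport ρ :=
  HasCompactSupport.intro (isCompact_closedBall 0 1) fun y hy => h.eq_zero y (by
    simp at hy; exact hy.le)

theorem contDiff_dilate (h : IsMollifier ρ S) (x : Eucl N) (r : ℝ) :
    ContDiff ℝ ∞ (dilate ρ x r) :=
  contDiff_const.mul (h.contDiff.comp (by fun_prop))

theorem abs_dilate_le (h : IsMollifier ρ S) (x w : Eucl N) {r : ℝ} (hr : 0 < r) :
    |dilate ρ x r w| ≤ (r ^ N)⁻¹ * S := by
  rw [dilate, abs_mul, abs_of_pos (inv_pos.2 (pow_pos hr N))]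
  exact mul_le_mul_of_nonneg_left (h.abs_le _) (by positivity)

theorem dilateDeriv_eq_zero (h : IsMollifier ρ S) {x w e : Eucl N} {r κ : ℝ} (hr : 0 < r)
    (hw : r < dist w x) : dilateDeriv ρ x r e κ w = 0 := by
  have : 1 < ‖r⁻¹ • (x - w)‖ := by
    rw [norm_smul, norm_inv, Real.norm_of_nonneg hr.le, ← dist_eq_norm, dist_comm, inv_mul_eq_div]
    exact (one_lt_div hr).2 hw
  simp [dilateDeriv, h.fderiv_eq_zero this, h.eq_zero _ this.le]

theorem abs_dilateDeriv_le (h : IsMollifier ρ S) {S' : ℝ} (hS' : ∀ y, ‖fderiv ℝ ρ y‖ ≤ S')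
    {x w e : Eucl N} {r κ : ℝ} (hr : 0 < r) :
    |dilateDeriv ρ x r e κ w| ≤ (r ^ N)⁻¹ * r⁻¹ * (S' * (‖e‖ + |κ|) + N * |κ| * S) := by
  have hS0 : 0 ≤ S' := (norm_nonneg _).trans (hS' 0)
  have hS := h.nonneg
  unfold dilateDeriv
  generalize r⁻¹ • (x - w) = y
  rw [abs_mul, abs_of_pos (by positivity : 0 < (r ^ N)⁻¹ * r⁻¹)]
  refine mul_le_mul_of_nonneg_left ?_ (by positivity)
  rcases lt_or_ge 1 ‖y‖ with hy | hy
  · simp only [h.fderiv_eq_zero hy, h.eq_zero y hy.le]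
    simp only [_root_.zero_apply, mul_zero, sub_self, abs_zero]
    positivity
  · refine (abs_sub _ _).trans (add_le_add ?_ ?_)
    · refine ((fderiv ℝ ρ y).le_opNorm _).trans ?_
      refine mul_le_mul (hS' y) ((norm_sub_le _ _).trans ?_) (norm_nonneg _) hS0
      rw [norm_smul, Real.norm_eq_abs]
      gcongr
      exact mul_le_of_le_one_right (abs_nonneg _) hy
    · rw [abs_mul, abs_mul, Nat.abs_cast]
      exact mul_le_mul_of_nonneg_left (h.abs_le y) (by positivity)

theorem continuous_dilateDeriv (h : IsMollifier ρ S) (x : Eucl N) (r : ℝ) (e : Eucl N) (κ : ℝ) :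
    Continuous (dilateDeriv ρ x r e κ) := by
  have h1 := h.contDiff.continuous_fderiv (by simp)
  have h2 := h.contDiff.continuous
  unfold dilateDeriv
  fun_prop

end IsMollifier

/-! ### Variation of averages under Morrey growth -/

/-- `u` has weak gradient `Du` in `Ω`, and `∫_{B_r(z)} |Du| ≤ C₀ r^{N-1+α}` whenever
`B_{3r}(z) ⊆ Ω`. -/
structure HasMorreyGrowth (α C₀ : ℝ) (Ω : Set (Eucl N)) (u : Eucl N → ℝ)
    (Du : Eucl N → Eucl N) : Prop where
  isWeakGradient : IsWeakGradient Ω u Du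
  integrableOn : ∀ K, IsCompact K → K ⊆ Ω → IntegrableOn u K
  integrableOn_gradient : ∀ K, IsCompact K → K ⊆ Ω → IntegrableOn Du K
  nonneg : 0 ≤ C₀
  growth : ∀ (z : Eucl N) (r : ℝ), 0 < r → Metric.ball z (3 * r) ⊆ Ω →
    ∫ x in Metric.ball z r, ‖Du x‖ ≤ C₀ * r ^ ((N : ℝ) - 1 + α)

section Mollify

variable {ρ : Eucl N → ℝ} {S α C₀ : ℝ} {Ω : Set (Eucl N)} {u : Eucl N → ℝ} {Du : Eucl N → Eucl N}

theorem closedBall_two_mul_subset {x : Eucl N} {r : ℝ} (hr : 0 < r)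
    (h : Metric.ball x (3 * r) ⊆ Ω) : Metric.closedBall x (2 * r) ⊆ Ω :=
  (Metric.closedBall_subset_ball (by linarith)).trans h

/-- The kernel is smooth, so the derivative first falls on it; `divergence_dilate` makes the result
a divergence in `w`, and integration by parts moves it onto `u`. -/
theorem hasDerivAt_mollify (hρ : IsMollifier ρ S) (hu : HasMorreyGrowth α C₀ Ω u Du)
    (a e : Eucl N) (c κ t : ℝ) (hr : 0 < c + t * κ)
    (hΩ : Metric.ball (a + t • e) (3 * (c + t * κ)) ⊆ Ω) :
    HasDerivAt (fun τ : ℝ => mollify ρ u (a + τ • e) (c + τ * κ))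
      (∫ w, inner ℝ (Du w) (dilate ρ (a + t • e) (c + t * κ) w •
        (e - κ • ((c + t * κ)⁻¹ • (a + t • e - w))))) t := by
  set x := a + t • e with hx
  set r := c + t * κ with hrdef
  have hK := isCompact_closedBall x (2 * r)
  have hKΩ := closedBall_two_mul_subset hr hΩ
  have huK := hu.integrableOn _ hK hKΩ
  obtain ⟨S', hS'⟩ := hρ.hasCompactSupport.fderiv (𝕜 := ℝ) |>.exists_bound_of_continuous
    (hρ.contDiff.continuous_fderiv (by simp))
  have hS0 : 0 ≤ S' := (norm_nonneg _).trans (hS' 0)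
  have hS := hρ.nonneg
  -- For these times the radius stays above `r / 2`, which bounds the kernel derivatives uniformly,
  -- and every kernel is supported in the fixed compact ball of radius `2 r`.
  set s : Set ℝ := {τ | r / 2 < c + τ * κ} ∩ {τ | c + τ * κ + dist (a + τ • e) x < 2 * r}
  have hs : s ∈ 𝓝 t := by
    refine inter_mem ((isOpen_lt (by fun_prop) (by fun_prop)).mem_nhds ?_)
      ((isOpen_lt (by fun_prop) (by fun_prop)).mem_nhds ?_)
    · simp only [mem_ofPred_eq]; linarith
    · simp only [mem_ofPred_eq, ← hx, dist_self]; linarith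
  have hpos : ∀ τ ∈ s, 0 < c + τ * κ := fun τ hτ => by
    have : r / 2 < c + τ * κ := hτ.1
    linarith
  have hout : ∀ τ ∈ s, ∀ w ∉ Metric.closedBall x (2 * r), c + τ * κ < dist w (a + τ • e) := by
    intro τ hτ w hw
    have h1 : c + τ * κ + dist (a + τ • e) x < 2 * r := hτ.2
    have h2 : 2 * r < dist w x := by simpa using hw
    linarith [dist_triangle w (a + τ • e) x]
  have hint : ∀ τ ∈ s, Integrable fun w => u w * dilate ρ (a + τ • e) (c + τ * κ) w := by
    intro τ hτ
    have := integrable_smul_of_isCompact hK huK (hρ.contDiff_dilate (a + τ • e) (c + τ * κ)).continuous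
      fun w hw => dilate_eq_zero hρ.eq_zero (hpos τ hτ) (hout τ hτ w hw).le
    simpa [mul_comm] using this
  have hint' : Integrable fun w => u w * dilateDeriv ρ x r e κ w := by
    have := integrable_smul_of_isCompact hK huK (hρ.continuous_dilateDeriv x r e κ)
      fun w hw => hρ.dilateDeriv_eq_zero hr (hout t (mem_of_mem_nhds hs) w hw)
    simpa [mul_comm] using this
  set M := ((r / 2) ^ N)⁻¹ * (r / 2)⁻¹ * (S' * (‖e‖ + |κ|) + N * |κ| * S)
  have hder := (hasDerivAt_integral_of_dominated_loc_of_deriv_le (μ := volume) (x₀ := t) (s := s)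
    (F := fun τ w => u w * dilate ρ (a + τ • e) (c + τ * κ) w)
    (F' := fun τ w => u w * dilateDeriv ρ (a + τ • e) (c + τ * κ) e κ w)
    (bound := (Metric.closedBall x (2 * r)).indicator fun w => ‖u w‖ * M) hs
    (by filter_upwards [hs] with τ hτ using (hint τ hτ).aestronglyMeasurable)
    (hint t (mem_of_mem_nhds hs)) hint'.aestronglyMeasurable ?_ ?_ ?_).2
  · change HasDerivAt _ _ t at hder
    refine hder.congr_deriv ?_
    simp_rw [← divergence_dilate hρ.contDiff]
    rw [hu.isWeakGradient.integral_divergence hK hKΩ huK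
      (hu.integrableOn_gradient _ hK hKΩ), ← integral_neg]
    · simp_rw [inner_neg_right, neg_neg]
      rfl
    · refine ((hρ.contDiff_dilate _ _).smul ?_).neg
      fun_prop
    · refine closure_minimal ?_ Metric.isClosed_closedBall
      intro w hw
      by_contra hwK
      have h0 := dilate_eq_zero hρ.eq_zero hr (hout t (mem_of_mem_nhds hs) w hwK).le
      exact hw (by beta_reduce; rw [h0]; simp)
  · refine Eventually.of_forall fun w τ hτ => ?_
    by_cases hw : w ∈ Metric.closedBall x (2 * r)
    · rw [indicator_of_mem hw, norm_mul]
      refine mul_le_mul_of_nonneg_left ((hρ.abs_dilateDeriv_le hS' (hpos τ hτ)).trans ?_)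
        (norm_nonneg _)
      have h1 : r / 2 ≤ c + τ * κ := le_of_lt hτ.1
      have h2 := hpos τ hτ
      simp only [M]
      gcongr
    · rw [indicator_of_notMem hw, hρ.dilateDeriv_eq_zero (hpos τ hτ) (hout τ hτ w hw)]
      simp
  · rw [integrable_indicator_iff Metric.isClosed_closedBall.measurableSet]
    exact huK.norm.mul_const M
  · exact Eventually.of_forall fun w τ hτ =>
      (hasDerivAt_dilate hρ.contDiff a e w c κ τ (hpos τ hτ)).const_mul (u w)

/-- The kernel contributes `S r^{-N}`, the velocity at most `‖e‖ + |κ|` on its support, and the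
growth of `Du` contributes `C₀ r^{N - 1 + α}`. -/
theorem norm_integral_inner_dilate_le (hρ : IsMollifier ρ S) (hu : HasMorreyGrowth α C₀ Ω u Du)
    (x e : Eucl N) (κ : ℝ) {r : ℝ} (hr : 0 < r) (hΩ : Metric.ball x (3 * r) ⊆ Ω) :
    ‖∫ w, inner ℝ (Du w) (dilate ρ x r w • (e - κ • (r⁻¹ • (x - w))))‖
      ≤ S * (‖e‖ + |κ|) * C₀ * r ^ (α - 1) := by
  have hS := hρ.nonneg
  have hDu : IntegrableOn Du (Metric.ball x r) :=
    (hu.integrableOn_gradient _ (isCompact_closedBall x (2 * r))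
      (closedBall_two_mul_subset hr hΩ)).mono_set
      (Metric.ball_subset_closedBall.trans (Metric.closedBall_subset_closedBall (by linarith)))
  have h0 : ∀ w ∉ Metric.ball x r,
      inner ℝ (Du w) (dilate ρ x r w • (e - κ • (r⁻¹ • (x - w)))) = 0 := by
    intro w hw
    rw [dilate_eq_zero hρ.eq_zero hr (by simpa using hw)]; simp
  rw [← setIntegral_eq_integral_of_forall_compl_eq_zero h0]
  have h1 : ‖∫ w in Metric.ball x r, inner ℝ (Du w) (dilate ρ x r w • (e - κ • (r⁻¹ • (x - w))))‖
      ≤ ∫ w in Metric.ball x r, ((r ^ N)⁻¹ * S * (‖e‖ + |κ|)) * ‖Du w‖ := by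
    refine norm_integral_le_of_norm_le (hDu.norm.const_mul _) ?_
    refine (ae_restrict_iff' measurableSet_ball).2 (Eventually.of_forall fun w hw => ?_)
    refine (norm_inner_le_norm _ _).trans ?_
    rw [mul_comm, norm_smul]
    refine mul_le_mul_of_nonneg_right ?_ (norm_nonneg _)
    refine mul_le_mul (hρ.abs_dilate_le x w hr) ?_ (norm_nonneg _) (by positivity)
    refine (norm_sub_le _ _).trans ?_
    rw [norm_smul, norm_smul, norm_inv, Real.norm_of_nonneg hr.le, ← dist_eq_norm,
      inv_mul_eq_div, Real.norm_eq_abs]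
    gcongr
    refine mul_le_of_le_one_right (abs_nonneg _) ((div_le_one hr).2 ?_)
    rw [dist_comm]; exact (Metric.mem_ball.1 hw).le
  refine h1.trans ?_
  rw [integral_const_mul]
  refine (mul_le_mul_of_nonneg_left (hu.growth x r hr hΩ) (by positivity)).trans (le_of_eq ?_)
  have : r ^ ((N : ℝ) - 1 + α) = r ^ N * r ^ (α - 1) := by
    rw [← Real.rpow_natCast, ← Real.rpow_add hr]; congr 1; ring
  rw [this]
  field_simp

theorem abs_mollify_sub_le_of_segment (hρ : IsMollifier ρ S) (hu : HasMorreyGrowth α C₀ Ω u Du)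
    {x y : Eucl N} {r : ℝ} (hr : 0 < r)
    (hΩ : ∀ t ∈ Icc (0 : ℝ) 1, Metric.ball (x + t • (y - x)) (3 * r) ⊆ Ω) :
    |mollify ρ u y r - mollify ρ u x r| ≤ S * C₀ * r ^ (α - 1) * ‖y - x‖ := by
  have h := norm_image_sub_le_of_norm_deriv_le_segment_01'
    (f := fun t : ℝ => mollify ρ u (x + t • (y - x)) (r + t * 0)) (C := S * C₀ * r ^ (α - 1) * ‖y - x‖)
    (fun t ht => (hasDerivAt_mollify hρ hu x (y - x) r 0 t (by simpa using hr)
      (by simpa using hΩ t ht)).hasDerivWithinAt)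
    (fun t ht => by
      have := norm_integral_inner_dilate_le hρ hu (x + t • (y - x)) (y - x) 0 (r := r + t * 0)
        (by simpa using hr) (by simpa using hΩ t ⟨ht.1, ht.2.le⟩)
      refine this.trans (le_of_eq ?_)
      simp; ring)
  simpa using h

/-- The average at `x + t e` has radius `t / 3`, so the tripled ball needed for the growth bound is
exactly the ball of radius `t`. Integrating the speed `D t^{α - 1}` gives a bound independent of the
lower end `s`; a nonzero `e` permits moving away from the boundary of `Ω`. -/
theorem abs_mollify_sub_le_of_cone (hρ : IsMollifier ρ S) (hu : HasMorreyGrowth α C₀ Ω u Du)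
    (hα : 0 < α) {x e : Eucl N} (he : ‖e‖ ≤ 1) {s T : ℝ} (hs : 0 < s) (hsT : s ≤ T)
    (hΩ : ∀ t ∈ Ioc (0 : ℝ) T, Metric.ball (x + t • e) t ⊆ Ω) :
    |mollify ρ u (x + T • e) (T * (1 / 3)) - mollify ρ u (x + s • e) (s * (1 / 3))|
      ≤ S * 2 * C₀ * (1 / 3) ^ (α - 1) / α * T ^ α := by
  have hS := hρ.nonneg
  have hC := hu.nonneg
  set D := S * 2 * C₀ * (1 / 3) ^ (α - 1) with hD
  have hder : ∀ t ∈ Icc s T, HasDerivAt (fun τ : ℝ => mollify ρ u (x + τ • e) (0 + τ * (1 / 3)))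
      _ t := fun t ht => hasDerivAt_mollify hρ hu x e 0 (1 / 3) t (by linarith [ht.1]) (by
        convert hΩ t ⟨by linarith [ht.1], ht.2⟩ using 2; ring)
  have hB : ∀ t ∈ Icc s T, HasDerivAt (fun t : ℝ => D / α * (t ^ α - s ^ α)) (D * t ^ (α - 1)) t := by
    intro t ht
    have h0 : t ≠ 0 := by linarith [ht.1]
    have := (((Real.hasDerivAt_rpow_const (p := α) (Or.inl h0)).sub_const (s ^ α))).const_mul (D / α)
    refine this.congr_deriv ?_
    field_simp
  have h := image_norm_le_of_norm_deriv_right_le_deriv_boundary'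
    (f := fun τ : ℝ => mollify ρ u (x + τ • e) (0 + τ * (1 / 3))
      - mollify ρ u (x + s • e) (0 + s * (1 / 3))) (a := s) (b := T)
    (fun t ht => ((hder t ht).sub_const _).continuousAt.continuousWithinAt)
    (fun t ht => ((hder t ⟨ht.1, ht.2.le⟩).sub_const _).hasDerivWithinAt)
    (B := fun t => D / α * (t ^ α - s ^ α)) (B' := fun t => D * t ^ (α - 1)) (by simp)
    (fun t ht => (hB t ht).continuousAt.continuousWithinAt)
    (fun t ht => (hB t ⟨ht.1, ht.2.le⟩).hasDerivWithinAt)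
    (fun t ht => by
      have ht0 : 0 < t := by linarith [ht.1]
      refine (norm_integral_inner_dilate_le hρ hu (x + t • e) e (1 / 3) (r := 0 + t * (1 / 3))
        (by linarith) ?_).trans ?_
      · convert hΩ t ⟨ht0, ht.2.le⟩ using 2; ring
      · rw [zero_add, Real.mul_rpow ht0.le (by norm_num), hD]
        have h1 : ‖e‖ + |(1 / 3 : ℝ)| ≤ 2 := by
          rw [abs_of_pos (by norm_num)]; linarith
        calc S * (‖e‖ + |1 / 3|) * C₀ * (t ^ (α - 1) * (1 / 3) ^ (α - 1))
            ≤ S * 2 * C₀ * (t ^ (α - 1) * (1 / 3) ^ (α - 1)) := by gcongr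
          _ = _ := by ring)
    (x := T) ⟨hsT, le_rfl⟩
  simp only [zero_add, Real.norm_eq_abs] at h
  refine h.trans (mul_le_mul_of_nonneg_left ?_ (by positivity))
  have := Real.rpow_nonneg hs.le α
  linarith

end Mollify

/-! ### The Hölder continuous representative -/

section Representative

variable {ρ : Eucl N → ℝ} {S α C₀ : ℝ} {Ω : Set (Eucl N)} {u : Eucl N → ℝ} {Du : Eucl N → Eucl N}

/-- The pointwise limit of the averages of `u` as the scale tends to zero. -/
def preciseRep (ρ u : Eucl N → ℝ) (x : Eucl N) : ℝ :=
  limUnder (𝓝[>] (0 : ℝ)) fun t => mollify ρ u x (t * (1 / 3))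

theorem tendsto_const_mul_rpow_zero (C : ℝ) (hα : 0 < α) :
    Tendsto (fun t : ℝ => C * t ^ α) (𝓝[>] 0) (𝓝 0) := by
  have h : Tendsto (fun t : ℝ => C * t ^ α) (𝓝 0) (𝓝 (C * 0 ^ α)) :=
    ((Real.continuousAt_rpow_const 0 α (Or.inr hα.le)).tendsto).const_mul C
  rw [Real.zero_rpow hα.ne', mul_zero] at h
  exact h.mono_left nhdsWithin_le_nhds

theorem tendsto_preciseRep (hρ : IsMollifier ρ S) (hu : HasMorreyGrowth α C₀ Ω u Du)
    (hα : 0 < α) {x : Eucl N} {R : ℝ} (hR : 0 < R) (hΩ : Metric.ball x R ⊆ Ω) :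
    Tendsto (fun t : ℝ => mollify ρ u x (t * (1 / 3))) (𝓝[>] 0) (𝓝 (preciseRep ρ u x)) := by
  refine tendsto_nhds_limUnder (cauchy_map_iff_exists_tendsto.1 ?_)
  rw [Metric.cauchy_iff]
  refine ⟨inferInstance, fun ε hε => ?_⟩
  set C := S * 2 * C₀ * (1 / 3) ^ (α - 1) / α
  have hcone : ∀ s t : ℝ, 0 < s → s ≤ t → t < R →
      |mollify ρ u x (t * (1 / 3)) - mollify ρ u x (s * (1 / 3))| ≤ C * t ^ α := by
    intro s t hs hst htR
    have := abs_mollify_sub_le_of_cone hρ hu hα (x := x) (e := 0) (by simp) hs hst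
      (fun τ hτ => by
        simpa using (Metric.ball_subset_ball (hτ.2.trans htR.le)).trans hΩ)
    simpa only [smul_zero, add_zero] using this
  have hev : ∀ᶠ t : ℝ in 𝓝[>] 0, C * t ^ α < ε ∧ 0 < t ∧ t < R :=
    ((tendsto_const_mul_rpow_zero C hα).eventually (gt_mem_nhds hε)).and
      (Ioo_mem_nhdsGT hR)
  refine ⟨_, image_mem_map hev, ?_⟩
  rintro _ ⟨s, hs, rfl⟩ _ ⟨t, ht, rfl⟩
  rcases le_total s t with h | h
  · rw [dist_comm]
    exact (hcone s t hs.2.1 h ht.2.2).trans_lt ht.1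
  · exact (hcone t s ht.2.1 h hs.2.2).trans_lt hs.1

/-- This is the limit `s → 0` in the cone estimate, once tilted and centred averages are known to
have the same limit. -/
theorem abs_mollify_sub_preciseRep_le (hρ : IsMollifier ρ S) (hu : HasMorreyGrowth α C₀ Ω u Du)
    (hα : 0 < α) (hΩo : IsOpen Ω) {x e : Eucl N} (hx : x ∈ Ω) (he : ‖e‖ ≤ 1) {T : ℝ} (hT : 0 < T)
    (hΩ : ∀ t ∈ Ioc (0 : ℝ) T, Metric.ball (x + t • e) t ⊆ Ω) :
    |mollify ρ u (x + T • e) (T * (1 / 3)) - preciseRep ρ u x|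
      ≤ S * 2 * C₀ * (1 / 3) ^ (α - 1) / α * T ^ α := by
  have hS := hρ.nonneg
  have hC := hu.nonneg
  obtain ⟨R, hR, hRΩ⟩ := Metric.isOpen_iff.1 hΩo x hx
  -- At scale `s / 3` the two centres are at distance at most `s`, so the segment estimate costs
  -- only a multiple of `s^{α - 1} s`.
  have h1 : Tendsto (fun s : ℝ => mollify ρ u (x + s • e) (s * (1 / 3)) -
      mollify ρ u x (s * (1 / 3))) (𝓝[>] 0) (𝓝 0) := by
    refine squeeze_zero_norm' ?_ (tendsto_const_mul_rpow_zero (S * C₀ * (1 / 3) ^ (α - 1)) hα)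
    filter_upwards [Ioo_mem_nhdsGT (show 0 < R / 2 by linarith)] with s hs
    have hs0 : 0 < s := hs.1
    have := abs_mollify_sub_le_of_segment hρ hu (x := x) (y := x + s • e) (r := s * (1 / 3))
      (by linarith) (fun t ht => by
        refine (Metric.ball_subset_ball' ?_).trans hRΩ
        rw [add_sub_cancel_left, dist_eq_norm, add_sub_cancel_left, norm_smul, norm_smul,
          Real.norm_of_nonneg ht.1, Real.norm_of_nonneg hs0.le]
        have : t * (s * ‖e‖) ≤ 1 * (s * 1) :=
          mul_le_mul ht.2 (mul_le_mul_of_nonneg_left he hs0.le) (by positivity) zero_le_one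
        linarith [hs.2])
    refine this.trans ?_
    rw [add_sub_cancel_left, norm_smul, Real.norm_of_nonneg hs0.le,
      Real.mul_rpow hs0.le (by norm_num), Real.rpow_sub_one hs0.ne']
    have h3 : s * ‖e‖ ≤ s * 1 := mul_le_mul_of_nonneg_left he hs0.le
    calc S * C₀ * (s ^ α / s * (1 / 3) ^ (α - 1)) * (s * ‖e‖)
        ≤ S * C₀ * (s ^ α / s * (1 / 3) ^ (α - 1)) * (s * 1) := by gcongr
      _ = _ := by field_simp
  have h2 : Tendsto (fun s : ℝ => mollify ρ u (x + s • e) (s * (1 / 3))) (𝓝[>] 0)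
      (𝓝 (preciseRep ρ u x)) := by
    simpa using h1.add (tendsto_preciseRep hρ hu hα hR hRΩ)
  refine le_of_tendsto ((h2.const_sub _).abs) ?_
  filter_upwards [Ioo_mem_nhdsGT hT] with s hs
  exact abs_mollify_sub_le_of_cone hρ hu hα he hs.1 hs.2.le hΩ

/-- Each point `z` climbs with velocity `(x₀ - z) / R`: at time `t` its distance to `x₀` has shrunk
by the factor `1 - t / R`, so the ball of radius `t` around it is still inside `B_R(x₀)`. Both
points climb to height `T`, where their averages are compared along a segment. -/
theorem abs_preciseRep_sub_le (hρ : IsMollifier ρ S) (hu : HasMorreyGrowth α C₀ Ω u Du)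
    (hα : 0 < α) (hΩo : IsOpen Ω) {x₀ : Eucl N} {R : ℝ} (hΩ : Metric.ball x₀ R ⊆ Ω) {x y : Eucl N}
    (hx : x ∈ Metric.ball x₀ R) (hy : y ∈ Metric.ball x₀ R) :
    |preciseRep ρ u x - preciseRep ρ u y|
      ≤ S * (1 / 3) ^ (α - 1) * (4 / α + 1) * C₀ * ‖x - y‖ ^ α := by
  have hS := hρ.nonneg
  have hC := hu.nonneg
  rcases eq_or_ne x y with rfl | hxy
  · simp [Real.zero_rpow hα.ne']
  have hR : 0 < R := Metric.pos_of_mem_ball hx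
  have hd : 0 < ‖x - y‖ := norm_sub_pos_iff.2 hxy
  set d := ‖x - y‖ with hddef
  set T := min d R with hTdef
  have hT : 0 < T := lt_min hd hR
  have hdir : ∀ z ∈ Metric.ball x₀ R, ‖R⁻¹ • (x₀ - z)‖ ≤ 1 := by
    intro z hz
    rw [norm_smul, norm_inv, Real.norm_of_nonneg hR.le, inv_mul_eq_div, ← dist_eq_norm, dist_comm]
    exact (div_le_one hR).2 (Metric.mem_ball.1 hz).le
  have hpath : ∀ z ∈ Metric.ball x₀ R, ∀ t ∈ Ioc (0 : ℝ) T,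
      z + t • R⁻¹ • (x₀ - z) ∈ Metric.closedBall x₀ (R - t) := by
    intro z hz t ht
    have htR : t / R ≤ 1 := (div_le_one hR).2 (ht.2.trans (min_le_right _ _))
    have e1 : z + t • R⁻¹ • (x₀ - z) - x₀ = (1 - t / R) • (z - x₀) := by
      rw [smul_smul, ← div_eq_mul_inv]; module
    rw [Metric.mem_closedBall, dist_eq_norm, e1, norm_smul, Real.norm_of_nonneg (by linarith),
      ← dist_eq_norm]
    calc (1 - t / R) * dist z x₀ ≤ (1 - t / R) * R :=
          mul_le_mul_of_nonneg_left (Metric.mem_ball.1 hz).le (by linarith)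
      _ = R - t := by field_simp
  have hball : ∀ z t, z ∈ Metric.closedBall x₀ (R - t) → Metric.ball z t ⊆ Ω := fun z t hz =>
    (Metric.ball_subset_ball' (by linarith [Metric.mem_closedBall.1 hz])).trans hΩ
  have hx1 := abs_mollify_sub_preciseRep_le hρ hu hα hΩo (hΩ hx) (hdir x hx) hT
    fun t ht => hball _ _ (hpath x hx t ht)
  have hy1 := abs_mollify_sub_preciseRep_le hρ hu hα hΩo (hΩ hy) (hdir y hy) hT
    fun t ht => hball _ _ (hpath y hy t ht)
  have hxy1 := abs_mollify_sub_le_of_segment hρ hu (x := x + T • R⁻¹ • (x₀ - x))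
    (y := y + T • R⁻¹ • (x₀ - y)) (r := T * (1 / 3)) (by linarith) (fun t ht => by
      have := hball _ _ (((convex_closedBall x₀ (R - T)).add_smul_sub_mem
        (hpath x hx T ⟨hT, le_rfl⟩) (hpath y hy T ⟨hT, le_rfl⟩) ht))
      convert this using 2; ring)
  have hdist : ‖y + T • R⁻¹ • (x₀ - y) - (x + T • R⁻¹ • (x₀ - x))‖ ≤ T := by
    have e1 : y + T • R⁻¹ • (x₀ - y) - (x + T • R⁻¹ • (x₀ - x)) = (1 - T / R) • (y - x) := by
      rw [smul_smul, smul_smul, ← div_eq_mul_inv]; module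
    have hTR : T / R ≤ 1 := (div_le_one hR).2 (min_le_right _ _)
    rw [e1, norm_smul, Real.norm_of_nonneg (by linarith), norm_sub_rev y x, ← hddef]
    -- If `T = d`, the contraction keeps the distance at most `d`; if `T = R`, both points have
    -- arrived at `x₀`.
    rcases min_choice d R with h | h
    · have : 0 ≤ T / R := by positivity
      rw [hTdef, h] at *
      nlinarith
    · have : T / R = 1 := by rw [hTdef, h]; exact div_self hR.ne'
      rw [this]; linarith
  have hTd : T ^ α ≤ d ^ α := Real.rpow_le_rpow hT.le (min_le_left _ _) hα.le
  have h3 : S * C₀ * (T * (1 / 3)) ^ (α - 1)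
      * ‖y + T • R⁻¹ • (x₀ - y) - (x + T • R⁻¹ • (x₀ - x))‖ ≤ S * C₀ * (1 / 3) ^ (α - 1) * T ^ α := by
    calc _ ≤ S * C₀ * (T * (1 / 3)) ^ (α - 1) * T := by gcongr
      _ = _ := by
        rw [Real.mul_rpow hT.le (by norm_num), Real.rpow_sub_one hT.ne']; field_simp
  have h4 : |preciseRep ρ u x - preciseRep ρ u y|
      ≤ S * (1 / 3) ^ (α - 1) * (4 / α + 1) * C₀ * T ^ α := by
    -- The two climbs contribute `2 / α` each, the segment contributes `1`.
    have e : S * (1 / 3) ^ (α - 1) * (4 / α + 1) * C₀ * T ^ α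
      = 2 * (S * 2 * C₀ * (1 / 3) ^ (α - 1) / α * T ^ α) + S * C₀ * (1 / 3) ^ (α - 1) * T ^ α := by
      ring
    rw [e]
    have := hxy1.trans h3
    rw [abs_le] at *
    constructor <;> linarith
  exact h4.trans (by gcongr)

theorem integral_dilate (hρ : IsMollifier ρ S) (x : Eucl N) {r : ℝ} (hr : 0 < r) :
    ∫ w, dilate ρ x r w = 1 := by
  unfold dilate
  rw [integral_const_mul, integral_sub_left_eq_self (fun w => ρ (r⁻¹ • w)) volume x,
    Measure.integral_comp_inv_smul, hρ.integral_eq_one, finrank_euclideanSpace_fin,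
    abs_of_pos (pow_pos hr N), smul_eq_mul, mul_one]
  exact inv_mul_cancel₀ (pow_pos hr N).ne'

/-- The kernel has mass one and is at most `S r^{-N}`, so the error is at most `S |B_1|` times the
mean oscillation on the ball. -/
theorem tendsto_mollify_of_tendsto_average (hρ : IsMollifier ρ S) (hu : LocallyIntegrable u)
    {y : Eucl N}
    (h : Tendsto (fun r => ⨍ w in Metric.closedBall y r, ‖u w - u y‖) (𝓝[>] 0) (𝓝 0)) :
    Tendsto (fun r => mollify ρ u y r) (𝓝[>] 0) (𝓝 (u y)) := by
  rw [tendsto_iff_norm_sub_tendsto_zero]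
  have h' := h.const_mul (S * volume.real (Metric.ball (0 : Eucl N) 1))
  rw [mul_zero] at h'
  refine squeeze_zero' (Eventually.of_forall fun _ => norm_nonneg _) ?_ h'
  filter_upwards [self_mem_nhdsWithin] with r hr
  have hr : 0 < r := hr
  have hK := isCompact_closedBall y r
  have huK := hu.integrableOn_isCompact hK
  have hdc := (hρ.contDiff_dilate y r).continuous
  have hd0 : ∀ w ∉ Metric.closedBall y r, dilate ρ y r w = 0 := fun w hw =>
    dilate_eq_zero hρ.eq_zero hr (by simpa using (not_le.1 hw).le)
  have hi1 := integrable_smul_of_isCompact hK huK hdc hd0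
  have hi2 := integrable_smul_of_isCompact hK (integrableOn_const hK.measure_lt_top.ne
    (C := u y)) hdc hd0
  have e1 : mollify ρ u y r - u y = ∫ w in Metric.closedBall y r, (u w - u y) * dilate ρ y r w := by
    rw [setIntegral_eq_integral_of_forall_compl_eq_zero (fun w hw => by simp [hd0 w hw])]
    have : u y = ∫ w, dilate ρ y r w • u y := by
      rw [integral_smul_const, integral_dilate hρ y hr, one_smul]
    conv_lhs => rw [this, mollify]
    simp_rw [mul_comm (u _) (dilate _ _ _ _), ← smul_eq_mul]
    rw [← integral_sub hi1 hi2]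
    congr 1; ext w; simp; ring
  rw [e1, setAverage_eq, smul_eq_mul]
  have h1 : ‖∫ w in Metric.closedBall y r, (u w - u y) * dilate ρ y r w‖
      ≤ ∫ w in Metric.closedBall y r, ((r ^ N)⁻¹ * S) * ‖u w - u y‖ := by
    refine norm_integral_le_of_norm_le
      ((huK.sub (integrableOn_const hK.measure_lt_top.ne)).norm.const_mul _)
      (Eventually.of_forall fun w => ?_)
    rw [norm_mul, mul_comm]
    exact mul_le_mul_of_nonneg_right (hρ.abs_dilate_le y w hr) (norm_nonneg _)
  refine h1.trans (le_of_eq ?_)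
  have hV : volume.real (Metric.ball (0 : Eucl N) 1) ≠ 0 :=
    (ENNReal.toReal_pos (Metric.measure_ball_pos _ _ one_pos).ne' measure_ball_lt_top.ne).ne'
  rw [integral_const_mul, measureReal_def (s := Metric.closedBall y r), Measure.addHaar_closedBall _ _ hr.le,
    finrank_euclideanSpace_fin, ENNReal.toReal_mul, ENNReal.toReal_ofReal (by positivity),
    ← measureReal_def]
  field_simp

theorem preciseRep_ae_eq (hρ : IsMollifier ρ S) (hu : HasMorreyGrowth α C₀ Ω u Du)
    (hα : 0 < α) (hΩo : IsOpen Ω) : preciseRep ρ u =ᵐ[volume.restrict Ω] u := by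
  rw [EventuallyEq, ae_restrict_iff' hΩo.measurableSet, ae_iff]
  refine measure_null_of_locally_null _ fun x hx => ?_
  simp only [Classical.not_imp, mem_ofPred_eq] at hx
  obtain ⟨R, hR, hRΩ⟩ := Metric.isOpen_iff.1 hΩo x hx.1
  set K := Metric.closedBall x (R / 2)
  have hKΩ : K ⊆ Ω := (Metric.closedBall_subset_ball (by linarith)).trans hRΩ
  -- Lebesgue differentiation needs local integrability on the whole space, so `u` is truncated to
  -- `K`; averages of scale below `R / 4` around points of `B_{R/4}(x)` do not see the truncation.
  have hloc : LocallyIntegrable (K.indicator u) :=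
    ((integrable_indicator_iff Metric.isClosed_closedBall.measurableSet).2
      (hu.integrableOn K (isCompact_closedBall _ _) hKΩ)).locallyIntegrable
  have hleb := IsUnifLocDoublingMeasure.ae_tendsto_average_norm_sub volume hloc 1
  refine ⟨Metric.ball x (R / 4) ∩ _, inter_mem (mem_nhdsWithin_of_mem_nhds
    (Metric.ball_mem_nhds x (by linarith))) self_mem_nhdsWithin, ?_⟩
  refine measure_mono_null ?_ (ae_iff.1 hleb)
  rintro y ⟨hyx, hy⟩ hlim
  simp only [Classical.not_imp, mem_ofPred_eq] at hy
  refine hy.2 ?_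
  have h1 := tendsto_mollify_of_tendsto_average hρ hloc
    (hlim (fun _ => y) id tendsto_id (by
      filter_upwards [self_mem_nhdsWithin] with r hr
      have hr : 0 < r := hr
      simpa using hr.le))
  have hyK : y ∈ K := Metric.ball_subset_closedBall (Metric.ball_subset_ball (by linarith) hyx)
  rw [indicator_of_mem hyK] at h1
  have hscale : Tendsto (fun t : ℝ => t * (1 / 3)) (𝓝[>] 0) (𝓝[>] 0) := by
    refine tendsto_nhdsWithin_of_tendsto_nhds_of_eventually_within _ ?_ ?_
    · have : Tendsto (fun t : ℝ => t * (1 / 3)) (𝓝 0) (𝓝 (0 * (1 / 3))) := tendsto_id.mul_const _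
      rw [zero_mul] at this
      exact this.mono_left nhdsWithin_le_nhds
    · filter_upwards [self_mem_nhdsWithin] with t ht
      have ht : 0 < t := ht
      exact mem_Ioi.2 (by linarith)
  have h2 := h1.comp hscale
  obtain ⟨R', hR', hRΩ'⟩ := Metric.isOpen_iff.1 hΩo y hy.1
  have h3 := tendsto_preciseRep hρ hu hα hR' hRΩ'
  refine tendsto_nhds_unique (h3.congr' ?_) h2
  filter_upwards [Ioo_mem_nhdsGT (show 0 < R / 4 by linarith)] with t ht
  have ht0 : 0 < t := ht.1
  simp only [Function.comp_apply, mollify]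
  congr 1
  ext w
  by_cases hw : w ∈ K
  · rw [indicator_of_mem hw]
  · rw [dilate_eq_zero hρ.eq_zero (by linarith), mul_zero, mul_zero]
    have hw' : R / 2 < dist w x := by simpa [K] using hw
    linarith [dist_triangle w y x, Metric.mem_ball.1 hyx, ht.2]

end Representative

/-- Morrey's Dirichlet growth theorem. The kernel is fixed before `Ω` and `u`, so `C` depends on `N`
and `α` alone. -/
theorem exists_holder_representative (N : ℕ) {α : ℝ} (hα : 0 < α) :
    ∃ C : ℝ, 0 ≤ C ∧ ∀ (C₀ : ℝ) (Ω : Set (Eucl N)) (u : Eucl N → ℝ) (Du : Eucl N → Eucl N),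
      IsOpen Ω → HasMorreyGrowth α C₀ Ω u Du →
      ∃ v : Eucl N → ℝ, v =ᵐ[volume.restrict Ω] u ∧
        ∀ (x₀ : Eucl N) (R : ℝ), Metric.ball x₀ R ⊆ Ω →
          ∀ x ∈ Metric.ball x₀ R, ∀ y ∈ Metric.ball x₀ R,
            |v x - v y| ≤ C * C₀ * ‖x - y‖ ^ α := by
  obtain ⟨ρ, S, hρ⟩ := exists_isMollifier N
  have := hρ.nonneg
  exact ⟨S * (1 / 3) ^ (α - 1) * (4 / α + 1), by positivity, fun C₀ Ω u Du hΩ hu =>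
    ⟨preciseRep ρ u, preciseRep_ae_eq hρ hu hα hΩ, fun x₀ R hR x hx y hy =>
      abs_preciseRep_sub_le hρ hu hα hΩ hR hx hy⟩⟩

/-- A function that is uniformly Hölder continuous on the balls contained in an open set is Hölder
continuous on the compact subsets of that set. -/
theorem isLocallyHolder_of_ball {α C : ℝ} (hα : 0 < α) (hα1 : α ≤ 1) {Ω : Set (Eucl N)}
    (hΩ : IsOpen Ω) {v : Eucl N → ℝ}
    (hv : ∀ (x₀ : Eucl N) (R : ℝ), Metric.ball x₀ R ⊆ Ω → ∀ x ∈ Metric.ball x₀ R,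
      ∀ y ∈ Metric.ball x₀ R, |v x - v y| ≤ C * ‖x - y‖ ^ α) :
    IsLocallyHolder α Ω v := by
  refine ⟨hα, hα1, fun K hK hKΩ => ?_⟩
  have hcont : ContinuousOn v K := by
    intro x hx
    obtain ⟨R, hR, hRΩ⟩ := Metric.isOpen_iff.1 hΩ x (hKΩ hx)
    refine ContinuousAt.continuousWithinAt ?_
    rw [ContinuousAt, tendsto_iff_norm_sub_tendsto_zero]
    have h0 : Tendsto (fun y => C * ‖y - x‖ ^ α) (𝓝 x) (𝓝 (C * ‖x - x‖ ^ α)) := by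
      refine Tendsto.const_mul C (Tendsto.rpow_const ?_ (Or.inr hα.le))
      exact (continuous_id.sub continuous_const).norm.tendsto x
    rw [sub_self, norm_zero, Real.zero_rpow hα.ne', mul_zero] at h0
    refine squeeze_zero' (Eventually.of_forall fun _ => norm_nonneg _) ?_ h0
    filter_upwards [Metric.ball_mem_nhds x hR] with y hy
    exact hv x R hRΩ y hy x (Metric.mem_ball_self hR)
  obtain ⟨M, hM⟩ := hK.exists_bound_of_continuousOn hcont
  obtain ⟨δ, hδ, hδΩ⟩ := hK.exists_thickening_subset_open hΩ hKΩ
  -- Points closer than `δ` share a ball inside `Ω`; for the others the bound `2 M` is compared with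
  -- `δ ^ α`.
  refine ⟨max C (2 * M / δ ^ α), fun x hx y hy => ?_⟩
  rcases lt_or_ge ‖x - y‖ δ with h | h
  · have hb : Metric.ball x δ ⊆ Ω := (Metric.ball_subset_thickening hx δ).trans hδΩ
    refine (hv x δ hb x (Metric.mem_ball_self hδ) y ?_).trans ?_
    · rwa [Metric.mem_ball, dist_comm, dist_eq_norm]
    · exact mul_le_mul_of_nonneg_right (le_max_left _ _) (by positivity)
  · have hM0 : 0 ≤ M := (norm_nonneg _).trans (hM x hx)
    have h1 : |v x - v y| ≤ 2 * M := by
      refine (abs_sub _ _).trans ?_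
      have := hM x hx; have := hM y hy
      simp only [Real.norm_eq_abs] at *
      linarith
    refine h1.trans ?_
    have hδα : 0 < δ ^ α := Real.rpow_pos_of_pos hδ α
    calc 2 * M = 2 * M / δ ^ α * δ ^ α := by field_simp
      _ ≤ max C (2 * M / δ ^ α) * ‖x - y‖ ^ α := by
        gcongr
        exact le_max_right _ _

/-! ### Caccioppoli estimate -/

/-- Weighted Young inequality: the right-hand side keeps the weight in front of `a ^ γ`. -/
theorem mul_rpow_mul_pow_le {p γ a ζ H : ℝ} {m : ℕ} (hp : 1 < p) (hγ : p < γ) (ha : 0 ≤ a)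
    (hζ : 0 ≤ ζ) (hζ1 : ζ ≤ 1) (hH : 0 ≤ H) (hm : γ / (γ - (p - 1)) ≤ (m : ℝ) + 1) :
    H * a ^ (p - 1) * ζ ^ m ≤ a ^ γ * ζ ^ (m + 1) + H ^ (γ / (γ - (p - 1))) := by
  set β := γ - (p - 1) with hβ
  have hβ0 : 0 < β := by linarith
  have hγβ : γ / β = 1 + (p - 1) / β := by field_simp; linarith
  have hHnn : 0 ≤ H ^ (γ / β) := Real.rpow_nonneg hH _
  -- Either `H` is small enough to be absorbed into the first term, or `a ^ β * ζ ≤ H`; then the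
  -- condition on `m` leaves enough powers of `ζ` to bound `a ^ (p - 1)` by a power of `H`.
  rcases le_total H (a ^ β * ζ) with h | h
  · have h1 : a ^ γ = a ^ β * a ^ (p - 1) := by
      rw [← Real.rpow_add_of_nonneg ha hβ0.le (by linarith)]; congr 1; linarith
    have : H * a ^ (p - 1) * ζ ^ m ≤ (a ^ β * ζ) * a ^ (p - 1) * ζ ^ m := by gcongr
    calc _ ≤ (a ^ β * ζ) * a ^ (p - 1) * ζ ^ m := this
      _ = a ^ γ * ζ ^ (m + 1) := by rw [h1]; ring
      _ ≤ _ := by linarith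
  · have h1 : ζ ^ m ≤ ζ ^ ((p - 1) / β) := by
      rw [← Real.rpow_natCast]
      exact Real.rpow_le_rpow_of_exponent_ge' hζ hζ1 (div_nonneg (by linarith) hβ0.le)
        (by rw [hγβ] at hm; linarith)
    have h2 : a ^ (p - 1) * ζ ^ ((p - 1) / β) ≤ H ^ ((p - 1) / β) := by
      have := Real.rpow_le_rpow (by positivity) h (div_nonneg (by linarith : 0 ≤ p - 1) hβ0.le)
      rwa [Real.mul_rpow (by positivity) hζ, ← Real.rpow_mul ha, mul_div_cancel₀ _ hβ0.ne'] at this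
    have h3 : 0 ≤ a ^ γ * ζ ^ (m + 1) := by positivity
    calc H * a ^ (p - 1) * ζ ^ m ≤ H * (a ^ (p - 1) * ζ ^ ((p - 1) / β)) := by
          rw [mul_assoc]; gcongr
      _ ≤ H * H ^ ((p - 1) / β) := by gcongr
      _ = H ^ (γ / β) := by
        rw [hγβ, Real.rpow_add_of_nonneg hH zero_le_one (div_nonneg (by linarith) hβ0.le),
          Real.rpow_one]
      _ ≤ _ := by linarith

/-- `χ` is a smooth cutoff between the ball of radius one and the ball of radius two, with gradient
bounded by `L`. -/
structure IsCutoff (χ : Eucl N → ℝ) (L : ℝ) : Prop where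
  contDiff : ContDiff ℝ ∞ χ
  nonneg : ∀ y, 0 ≤ χ y
  le_one : ∀ y, χ y ≤ 1
  eq_one : ∀ y, ‖y‖ ≤ 1 → χ y = 1
  eq_zero : ∀ y, 2 ≤ ‖y‖ → χ y = 0
  norm_fderiv_le : ∀ y, ‖fderiv ℝ χ y‖ ≤ L

theorem exists_isCutoff (N : ℕ) : ∃ (χ : Eucl N → ℝ) (L : ℝ), IsCutoff χ L := by
  let φ : ContDiffBump (0 : Eucl N) := ⟨1, 2, by norm_num, by norm_num⟩
  obtain ⟨L, hL⟩ := (φ.hasCompactSupport.fderiv (𝕜 := ℝ)).exists_bound_of_continuous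
    ((φ.contDiff (n := ⊤)).continuous_fderiv (by simp))
  refine ⟨φ, L, φ.contDiff, fun y => φ.nonneg, fun y => φ.le_one, fun y hy => ?_, fun y hy => ?_,
    hL⟩
  · exact φ.one_of_mem_closedBall (by simpa [φ] using hy)
  · exact φ.zero_of_le_dist (by simpa [φ] using hy)

namespace IsCutoff

variable {χ : Eucl N → ℝ} {L : ℝ}

theorem bound_nonneg (h : IsCutoff χ L) : 0 ≤ L := (norm_nonneg _).trans (h.norm_fderiv_le 0)

theorem rescale_eq_zero (h : IsCutoff χ L) {x z : Eucl N} {r : ℝ} (hr : 0 < r)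
    (hx : x ∉ Metric.ball z (2 * r)) : χ (r⁻¹ • (x - z)) = 0 := by
  refine h.eq_zero _ ?_
  rw [norm_smul, norm_inv, Real.norm_of_nonneg hr.le, ← dist_eq_norm, inv_mul_eq_div]
  exact (le_div_iff₀ hr).2 (by simpa using hx)

theorem rescale_eq_one (h : IsCutoff χ L) {x z : Eucl N} {r : ℝ} (hr : 0 < r)
    (hx : x ∈ Metric.ball z r) : χ (r⁻¹ • (x - z)) = 1 := by
  refine h.eq_one _ ?_
  rw [norm_smul, norm_inv, Real.norm_of_nonneg hr.le, ← dist_eq_norm, inv_mul_eq_div]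
  exact (div_le_one hr).2 (Metric.mem_ball.1 hx).le

theorem norm_gradient_rescale_pow_le (h : IsCutoff χ L) (x z : Eucl N) {r : ℝ} (hr : 0 < r)
    (m : ℕ) : ‖gradient (fun x => χ (r⁻¹ • (x - z)) ^ (m + 1)) x‖
      ≤ (m + 1) * χ (r⁻¹ • (x - z)) ^ m * (L / r) := by
  have hy : HasFDerivAt (fun x : Eucl N => r⁻¹ • (x - z))
      (r⁻¹ • ContinuousLinearMap.id ℝ (Eucl N)) x :=
    ((hasFDerivAt_id (𝕜 := ℝ) x).sub_const z).fun_const_smul r⁻¹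
  have h1 := (((h.contDiff.differentiable (by simp)) (r⁻¹ • (x - z))).hasFDerivAt.comp x hy).pow
    (m + 1)
  have h2 : fderiv ℝ (fun x => χ (r⁻¹ • (x - z)) ^ (m + 1)) x = _ := h1.fderiv
  rw [gradient, LinearIsometryEquiv.norm_map, h2, norm_smul]
  have hn := h.nonneg (r⁻¹ • (x - z))
  simp only [Nat.add_sub_cancel, Function.comp_apply]
  have e : ‖(m + 1) • χ (r⁻¹ • (x - z)) ^ m‖ = (m + 1) * χ (r⁻¹ • (x - z)) ^ m := by
    rw [Real.norm_of_nonneg (by positivity)]; simp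
  rw [e]
  refine mul_le_mul_of_nonneg_left ?_ (by positivity)
  rw [ContinuousLinearMap.comp_smul, ContinuousLinearMap.comp_id, norm_smul, norm_inv,
    Real.norm_of_nonneg hr.le, inv_mul_eq_div]
  gcongr
  exact h.norm_fderiv_le _

end IsCutoff

/-- The Caccioppoli-type estimate obtained by testing with a power of a cutoff function. -/
theorem IsDistribSupersolution.integral_gradient_rpow_le {p γ ν cH lam L : ℝ} {Ω : Set (Eucl N)}
    {A : Eucl N → ℝ → Eucl N → Eucl N} {B : Eucl N → ℝ → Eucl N → ℝ} {f u χ : Eucl N → ℝ}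
    {Du : Eucl N → Eucl N} {m : ℕ} (hsol : IsDistribSupersolution p Ω A B u Du)
    (hΩ : IsOpen Ω) (hp : 1 < p) (hγ : p < γ) (hν : 0 < ν) (hcH : 0 < cH) (hlam : 0 ≤ lam)
    (hA : GrowthA p ν Ω A) (hB : LowerBoundB γ cH lam f Ω B) (hf : IntegrableOn f Ω)
    (hlu : IntegrableOn (fun x => lam * max (u x) 0) Ω) (hu : MemW1Loc γ Ω u Du)
    (hχ : IsCutoff χ L) (hm : γ / (γ - (p - 1)) ≤ (m : ℝ) + 1) {z : Eucl N} {r : ℝ} (hr : 0 < r)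
    (hz : Metric.ball z (3 * r) ⊆ Ω) :
    cH / 2 * ∫ x in Metric.ball z r, ‖Du x‖ ^ γ
      ≤ (∫ x in Metric.ball z (2 * r), lam * max (u x) 0) + (∫ x in Metric.ball z (2 * r), |f x|)
        + cH / 2 * (ν * (m + 1) * (L / r) / (cH / 2)) ^ (γ / (γ - (p - 1)))
          * volume.real (Metric.ball z (2 * r)) := by
  have hL := hχ.bound_nonneg
  set V := Metric.ball z (2 * r)
  set Kc := Metric.closedBall z (2 * r)
  have hK : IsCompact Kc := isCompact_closedBall _ _
  have hKΩ : Kc ⊆ Ω := closedBall_two_mul_subset hr hz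
  have hVK : V ⊆ Kc := Metric.ball_subset_closedBall
  have hVΩ : V ⊆ Ω := hVK.trans hKΩ
  set ζ : Eucl N → ℝ := fun x => χ (r⁻¹ • (x - z)) with hζ
  set φ : Eucl N → ℝ := fun x => ζ x ^ (m + 1) with hφ
  have hζ0 : ∀ x ∉ V, ζ x = 0 := fun x hx => hχ.rescale_eq_zero hr hx
  have hφ0 : ∀ x ∉ V, φ x = 0 := fun x hx => by simp [hφ, hζ0 x hx]
  have hζn : ∀ x, 0 ≤ ζ x := fun x => hχ.nonneg _
  have hφn : ∀ x, 0 ≤ φ x := fun x => pow_nonneg (hζn x) _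
  have hφ1 : ∀ x, φ x ≤ 1 := fun x => pow_le_one₀ (hζn x) (hχ.le_one _)
  have hφs : ContDiff ℝ ∞ φ := (hχ.contDiff.comp (by fun_prop)).pow _
  have hts : tsupport φ ⊆ Kc := closure_minimal
    (fun x hx => by by_contra h; exact hx (hφ0 x fun h' => h (hVK h'))) Metric.isClosed_closedBall
  -- `p > 1` makes `γ / (γ - (p - 1))` exceed one, so `m ≥ 1` and the gradient bound with factor `ζ
  -- ^ m` vanishes where `ζ` does.
  have hmpos : 0 < m := by
    rcases Nat.eq_zero_or_pos m with h | h
    · rw [h, Nat.cast_zero, zero_add, div_le_one (by linarith)] at hm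
      linarith
    · exact h
  have hgrad0 : ∀ x ∉ V, gradient φ x = 0 := by
    intro x hx
    have := hχ.norm_gradient_rescale_pow_le x z hr m
    rw [show χ (r⁻¹ • (x - z)) = 0 from hζ0 x hx, zero_pow hmpos.ne'] at this
    exact norm_le_zero_iff.1 (by simpa using this)
  have htest := hsol.inequality φ (hφs.of_le (by simp)) (hK.of_isClosed_subset
    (isClosed_tsupport _) hts) (hts.trans hKΩ) hφn
  rw [setIntegral_eq_of_subset_of_forall_sdiff_eq_zero hΩ.measurableSet hVΩ
      (fun x hx => by simp [hφ0 x hx.2]),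
    setIntegral_eq_of_subset_of_forall_sdiff_eq_zero hΩ.measurableSet hVΩ
      (fun x hx => by simp [hgrad0 x hx.2])] at htest
  have hmulφ : ∀ g : Eucl N → ℝ, IntegrableOn g Kc → IntegrableOn (fun x => g x * φ x) V :=
    fun g hg => (hg.mul_continuousOn hφs.continuous.continuousOn hK).mono_set hVK
  have hDuγ : IntegrableOn (fun x => ‖Du x‖ ^ γ) Kc := by
    have := (hu.memLpLoc_gradient Kc hK hKΩ).integrable_norm_rpow
      (by simp; linarith) ENNReal.ofReal_ne_top
    rwa [ENNReal.toReal_ofReal (by linarith)] at this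
  have hBi : IntegrableOn (fun x => B x (u x) (Du x)) Kc := hsol.memLpLoc_B.integrableOn le_rfl hK hKΩ
  have hDφ := hmulφ _ hDuγ
  have hdata : IntegrableOn (fun x => lam * max (u x) 0 + |f x|) V :=
    (hlu.mono_set hVΩ).add (hf.mono_set hVΩ).abs
  have hdataφ : IntegrableOn (fun x => (lam * max (u x) 0 + |f x|) * φ x) V :=
    hmulφ _ ((hlu.mono_set hKΩ).add (hf.mono_set hKΩ).abs)
  have haeV : ∀ {P : Eucl N → Prop}, (∀ᵐ x ∂(volume.restrict Ω), P x) →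
      ∀ᵐ x ∂(volume.restrict V), P x := fun h => ae_restrict_of_ae_restrict_of_subset hVΩ h
  have hlower : ∫ x in V, (cH * (‖Du x‖ ^ γ * φ x) - (lam * max (u x) 0 + |f x|) * φ x)
      ≤ ∫ x in V, B x (u x) (Du x) * φ x := by
    refine integral_mono_ae ((hDφ.const_mul cH).sub hdataφ) (hmulφ _ hBi) ?_
    filter_upwards [haeV hB] with x hx
    have h1 := hx (u x) (Du x)
    have h2 : lam * u x ≤ lam * max (u x) 0 := mul_le_mul_of_nonneg_left (le_max_left _ _) hlam
    have h3 := le_abs_self (f x)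
    have := mul_le_mul_of_nonneg_right (show cH * ‖Du x‖ ^ γ - (lam * max (u x) 0 + |f x|)
      ≤ B x (u x) (Du x) by linarith) (hφn x)
    linarith
  -- Young's remainder, with `cH / 2` factored out so that the flux uses up only half of the
  -- coercive term.
  set E := cH / 2 * (ν * (m + 1) * (L / r) / (cH / 2)) ^ (γ / (γ - (p - 1)))
  have hupper : ∫ x in V, inner ℝ (A x (u x) (Du x)) (gradient φ x)
      ≤ ∫ x in V, (cH / 2 * (‖Du x‖ ^ γ * φ x) + E) := by
    have hi : IntegrableOn (fun x => cH / 2 * (‖Du x‖ ^ γ * φ x) + E) V :=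
      (hDφ.const_mul (cH / 2)).add (integrableOn_const measure_ball_lt_top.ne)
    refine (Real.le_norm_self _).trans (norm_integral_le_of_norm_le hi ?_)
    filter_upwards [haeV hA] with x hx
    refine (norm_inner_le_norm _ _).trans ((mul_le_mul (hx (u x) (Du x))
      (hχ.norm_gradient_rescale_pow_le x z hr m) (norm_nonneg _) (by positivity)).trans ?_)
    have := mul_le_mul_of_nonneg_left (mul_rpow_mul_pow_le (ζ := ζ x)
      (H := ν * (m + 1) * (L / r) / (cH / 2)) hp hγ (norm_nonneg (Du x)) (hζn x)
      (hχ.le_one _) (by positivity) hm) (by positivity : 0 ≤ cH / 2)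
    refine le_trans (le_of_eq ?_) (this.trans (le_of_eq ?_))
    · simp only [hζ]; field_simp
    · simp only [E, hφ]; ring
  -- The integral of `‖Du x‖ ^ γ * φ x` is finite because `u ∈ W^{1,γ}_loc`, so it may be subtracted
  -- from both sides.
  have hchain := hlower.trans (htest.trans hupper)
  rw [integral_sub (hDφ.const_mul cH) hdataφ, integral_add (hDφ.const_mul (cH / 2))
    (integrableOn_const measure_ball_lt_top.ne (C := E)), integral_const_mul, integral_const_mul,
    setIntegral_const, smul_eq_mul] at hchain
  have hdle : ∫ x in V, (lam * max (u x) 0 + |f x|) * φ x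
      ≤ (∫ x in V, lam * max (u x) 0) + ∫ x in V, |f x| := by
    rw [← integral_add (hlu.mono_set hVΩ) (hf.mono_set hVΩ).abs]
    refine integral_mono hdataφ hdata fun x => ?_
    exact mul_le_of_le_one_right (add_nonneg (mul_nonneg hlam (le_max_right _ _)) (abs_nonneg _))
      (hφ1 x)
  have hball : ∫ x in Metric.ball z r, ‖Du x‖ ^ γ ≤ ∫ x in V, ‖Du x‖ ^ γ * φ x := by
    have e : ∫ x in Metric.ball z r, ‖Du x‖ ^ γ = ∫ x in Metric.ball z r, ‖Du x‖ ^ γ * φ x :=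
      setIntegral_congr_fun measurableSet_ball fun x hx => by
        simp [hφ, hζ, hχ.rescale_eq_one hr hx]
    rw [e]
    exact setIntegral_mono_set hDφ (Eventually.of_forall fun x => mul_nonneg
      (Real.rpow_nonneg (norm_nonneg _) _) (hφn x))
      (Metric.ball_subset_ball (by linarith)).eventuallyLE
  have := mul_le_mul_of_nonneg_left hball (by positivity : 0 ≤ cH / 2)
  linarith

/-! ### From Morrey data to gradient growth -/

theorem setIntegral_abs_le_of_morreyNorm_le {θ R : ℝ} {M : ℝ≥0} {Ω : Set (Eucl N)}
    {h : Eucl N → ℝ} (hh : IntegrableOn h Ω) (hM : morreyNorm 1 θ Ω h ≤ M) {z : Eucl N}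
    (hz : z ∈ Ω) (hR : 0 < R) (hRd : ENNReal.ofReal R ≤ Metric.ediam Ω)
    (hΩ : Metric.ball z R ⊆ Ω) : ∫ x in Metric.ball z R, |h x| ≤ M * R ^ ((N : ℝ) - θ) := by
  have h1 : ENNReal.ofReal (R ^ ((θ - N) / 1)) *
      eLpNorm h (ENNReal.ofReal 1) (volume.restrict (Metric.ball z R ∩ Ω)) ≤ M := by
    refine le_trans ?_ hM
    unfold morreyNorm
    exact le_iSup_of_le z (le_iSup_of_le hz (le_iSup_of_le R (le_iSup_of_le hR
      (le_iSup_of_le hRd le_rfl))))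
  rw [inter_eq_left.2 hΩ, ENNReal.ofReal_one, eLpNorm_one_eq_lintegral_enorm, div_one] at h1
  have h2 := ENNReal.toReal_mono ENNReal.coe_ne_top h1
  rw [ENNReal.toReal_mul, ENNReal.toReal_ofReal (by positivity), ENNReal.coe_toReal,
    ← integral_norm_eq_lintegral_enorm (hh.mono_set hΩ).aestronglyMeasurable] at h2
  have h3 : R ^ ((N : ℝ) - θ) * R ^ (θ - N) = 1 := by
    rw [← Real.rpow_add hR]; simp
  have h4 : 0 < R ^ ((N : ℝ) - θ) := Real.rpow_pos_of_pos hR _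
  calc ∫ x in Metric.ball z R, |h x|
      = R ^ ((N : ℝ) - θ) * (R ^ (θ - N) * ∫ x in Metric.ball z R, ‖h x‖) := by
        rw [← mul_assoc, h3, one_mul]; rfl
    _ ≤ R ^ ((N : ℝ) - θ) * M := by gcongr
    _ = _ := mul_comm _ _

/-- Above the level `l` the factor `(a / l) ^ (γ - 1)` is at least one. This replaces Hölder's
inequality when passing from `|Du|^γ` to `|Du|`. -/
theorem le_add_rpow_mul_rpow {l a γ : ℝ} (hl : 0 < l) (ha : 0 ≤ a) (hγ : 1 ≤ γ) :
    a ≤ l + l ^ (1 - γ) * a ^ γ := by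
  rcases le_total a l with h | h
  · have : 0 ≤ l ^ (1 - γ) * a ^ γ := by positivity
    linarith
  · have ha' : 0 < a := hl.trans_le h
    have h1 : 1 ≤ (a / l) ^ (γ - 1) := Real.one_le_rpow ((one_le_div hl).2 h) (by linarith)
    have h2 : l ^ (1 - γ) * a ^ γ = a * (a / l) ^ (γ - 1) := by
      rw [Real.div_rpow ha hl.le, Real.rpow_sub_one ha'.ne', ← neg_sub γ 1, Real.rpow_neg hl.le]
      field_simp
    rw [h2]
    nlinarith

/-- Bounded radii let a larger exponent be traded for a smaller one; this is how `diam Ω` enters the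
constants. -/
theorem rpow_le_rpow_sub_mul_rpow {r D a b : ℝ} (hr : 0 < r) (hrD : r ≤ D) (hab : b ≤ a) :
    r ^ a ≤ D ^ (a - b) * r ^ b := by
  have : r ^ a = r ^ (a - b) * r ^ b := by rw [← Real.rpow_add hr]; congr 1; ring
  rw [this]
  exact mul_le_mul_of_nonneg_right (Real.rpow_le_rpow hr.le hrD (by linarith)) (by positivity)

/-- A bound for the averages of `|Du| ^ γ` on balls gives one for the averages of `|Du|`. -/
theorem integral_norm_le_of_integral_rpow_le {Du : Eucl N → Eucl N} {γ α C r : ℝ} (hγ : 1 ≤ γ)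
    (hr : 0 < r) {z : Eucl N} (hDu : IntegrableOn Du (Metric.ball z r))
    (hDuγ : IntegrableOn (fun x => ‖Du x‖ ^ γ) (Metric.ball z r))
    (h : ∫ x in Metric.ball z r, ‖Du x‖ ^ γ ≤ C * r ^ ((N : ℝ) - γ + γ * α)) :
    ∫ x in Metric.ball z r, ‖Du x‖
      ≤ (volume.real (Metric.ball (0 : Eucl N) 1) + C) * r ^ ((N : ℝ) - 1 + α) := by
  -- At the splitting level `r ^ (α - 1)` both contributions scale like `r ^ (N - 1 + α)`.
  have hl : 0 < r ^ (α - 1) := Real.rpow_pos_of_pos hr _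
  have hc : IntegrableOn (fun _ : Eucl N => r ^ (α - 1)) (Metric.ball z r) :=
    integrableOn_const measure_ball_lt_top.ne
  have h1 : ∫ x in Metric.ball z r, ‖Du x‖
      ≤ ∫ x in Metric.ball z r, (r ^ (α - 1) + (r ^ (α - 1)) ^ (1 - γ) * ‖Du x‖ ^ γ) :=
    integral_mono hDu.norm (hc.add (hDuγ.const_mul _))
      fun x => le_add_rpow_mul_rpow hl (norm_nonneg _) hγ
  rw [integral_add hc (hDuγ.const_mul _), integral_const_mul, setIntegral_const,
    measureReal_def, Measure.addHaar_ball_of_pos _ _ hr, finrank_euclideanSpace_fin,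
    ENNReal.toReal_mul, ENNReal.toReal_ofReal (by positivity), ← measureReal_def, smul_eq_mul] at h1
  refine h1.trans ?_
  have e1 : r ^ N * r ^ (α - 1) = r ^ ((N : ℝ) - 1 + α) := by
    rw [← Real.rpow_natCast, ← Real.rpow_add hr]; congr 1; ring
  have e2 : (r ^ (α - 1)) ^ (1 - γ) * r ^ ((N : ℝ) - γ + γ * α) = r ^ ((N : ℝ) - 1 + α) := by
    rw [← Real.rpow_mul hr.le, ← Real.rpow_add hr]; congr 1; ring
  have h2 := mul_le_mul_of_nonneg_left h (by positivity : 0 ≤ (r ^ (α - 1)) ^ (1 - γ))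
  calc _ ≤ r ^ N * volume.real (Metric.ball (0 : Eucl N) 1) * r ^ (α - 1)
        + (r ^ (α - 1)) ^ (1 - γ) * (C * r ^ ((N : ℝ) - γ + γ * α)) := by gcongr
    _ = volume.real (Metric.ball (0 : Eucl N) 1) * (r ^ N * r ^ (α - 1))
        + C * ((r ^ (α - 1)) ^ (1 - γ) * r ^ ((N : ℝ) - γ + γ * α)) := by ring
    _ = _ := by rw [e1, e2]; ring

/-- A ball of radius `3 r` inside `Ω` forces `2 r ≤ diam Ω`. -/
theorem exists_dist_eq_of_ball_subset (hN : 2 ≤ N) {Ω : Set (Eucl N)} {z : Eucl N} {r : ℝ}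
    (hr : 0 < r) (hz : Metric.ball z (3 * r) ⊆ Ω) : ∃ w ∈ Ω, dist w z = 2 * r := by
  have h : dist (z + (2 * r) • EuclideanSpace.single (⟨0, by omega⟩ : Fin N) (1 : ℝ)) z
      = 2 * r := by
    rw [dist_eq_norm, add_sub_cancel_left, norm_smul, PiLp.norm_single, norm_one,
      mul_one, Real.norm_of_nonneg (by linarith)]
  exact ⟨_, hz (by rw [Metric.mem_ball, h]; linarith), h⟩

theorem holderExponent_pos {p q γ : ℝ} (hp : 1 < p) (hγ : p < γ) (hq : 1 ≤ q) (hqγ : N / γ < q) :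
    0 < holderExponent N p q γ := by
  refine lt_min ?_ (div_pos (by linarith) (by linarith))
  rw [sub_pos, div_lt_one (by nlinarith)]
  exact (div_lt_iff₀ (by linarith)).1 hqγ

theorem holderExponent_le_one {p q γ : ℝ} (hp : 1 < p) (hγ : p < γ) (hq : 1 ≤ q) :
    holderExponent N p q γ ≤ 1 := by
  refine (min_le_left _ _).trans ?_
  have : 0 ≤ (N : ℝ) / (q * γ) := div_nonneg (Nat.cast_nonneg _) (by nlinarith)
  linarith

/-- Supersolutions have a gradient of Morrey growth, with uniform constants. -/
theorem exists_hasMorreyGrowth (hN : 2 ≤ N) {p q γ ν cH : ℝ} (hp : 1 < p) (hγ : p < γ)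
    (hq : 1 ≤ q) (hν : 0 < ν) (hcH : 0 < cH) {Ω : Set (Eucl N)} (hΩ : IsOpen Ω)
    (hΩb : Bornology.IsBounded Ω) (M₁ M₂ : ℝ≥0) :
    ∃ C₀ : ℝ, 0 ≤ C₀ ∧ ∀ (A : Eucl N → ℝ → Eucl N → Eucl N) (B : Eucl N → ℝ → Eucl N → ℝ)
      (lam : ℝ) (f u : Eucl N → ℝ) (Du : Eucl N → Eucl N), GrowthA p ν Ω A →
      0 ≤ lam → LowerBoundB γ cH lam f Ω B →
      MemMorrey 1 (N / q) Ω f → morreyNorm 1 (N / q) Ω f ≤ M₁ →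
      MemMorrey 1 (N / q) Ω (fun x => lam * max (u x) 0) →
      morreyNorm 1 (N / q) Ω (fun x => lam * max (u x) 0) ≤ M₂ →
      MemW1Loc γ Ω u Du → IsDistribSupersolution p Ω A B u Du →
      HasMorreyGrowth (holderExponent N p q γ) C₀ Ω u Du := by
  obtain ⟨χ, L, hχ⟩ := exists_isCutoff N
  have hL := hχ.bound_nonneg
  obtain ⟨m, hm⟩ := exists_nat_ge (γ / (γ - (p - 1)))
  replace hm : γ / (γ - (p - 1)) ≤ (m : ℝ) + 1 := hm.trans (by linarith)
  set α := holderExponent N p q γ with hα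
  set D := Metric.diam Ω
  have hD : 0 ≤ D := Metric.diam_nonneg
  set g := γ / (γ - (p - 1)) with hg
  -- The target exponent for `∫ |Du|^γ`. The two entries of the minimum defining `α` give `b ≤ N - N
  -- / q` (data) and `b ≤ N - g` (Young remainder).
  set b : ℝ := N - γ + γ * α with hb
  have hβ : 0 < γ - (p - 1) := by linarith
  have hb1 : b ≤ N - N / q := by
    have h1 : γ * α ≤ γ * (1 - N / (q * γ)) :=
      mul_le_mul_of_nonneg_left (min_le_left _ _) (by linarith)
    have h2 : γ * (1 - N / (q * γ)) = γ - N / q := by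
      have : γ ≠ 0 := by linarith
      have : q ≠ 0 := by linarith
      field_simp
    linarith
  have hb2 : b ≤ N - g := by
    have h1 : γ * α ≤ γ * ((γ - p) / (γ - (p - 1))) :=
      mul_le_mul_of_nonneg_left (min_le_right _ _) (by linarith)
    have h2 : γ * ((γ - p) / (γ - (p - 1))) = γ - g := by rw [hg]; field_simp; ring
    linarith
  set V₁ := volume.real (Metric.ball (0 : Eucl N) 1)
  set G := ν * (m + 1) * L / (cH / 2) with hG
  have hG0 : 0 ≤ G := by positivity
  -- The Caccioppoli bound divided by `cH / 2`: `2 ^ b` and `2 ^ N` come from the radius `2 r`, the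
  -- powers of `D` from lowering the exponents to `b`.
  set C₁ := 2 / cH * ((M₂ + M₁) * (D ^ ((N : ℝ) - N / q - b) * 2 ^ b)
    + cH / 2 * (G ^ g * (2 ^ N * V₁) * D ^ ((N : ℝ) - g - b))) with hC₁
  refine ⟨V₁ + C₁, by positivity, fun A B lam f u Du hA hlam hB hf hf1 hlu hlu1 hu hsol => ?_⟩
  have hfi : IntegrableOn f Ω := by
    have := hf.1
    rwa [ENNReal.ofReal_one, memLp_one_iff_integrable] at this
  have hlui : IntegrableOn (fun x => lam * max (u x) 0) Ω := by
    have := hlu.1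
    rwa [ENNReal.ofReal_one, memLp_one_iff_integrable] at this
  have hγ1 : 1 ≤ γ := by linarith
  refine ⟨hu.isWeakGradient, fun K hK hKΩ => hu.memLpLoc.integrableOn hγ1 hK hKΩ,
    fun K hK hKΩ => hu.memLpLoc_gradient.integrableOn hγ1 hK hKΩ, by positivity,
    fun z r hr hz => ?_⟩
  -- The Morrey norm tests only radii up to `diam Ω`, so the radius `2 r` must be shown admissible.
  obtain ⟨w, hw, hwz⟩ := exists_dist_eq_of_ball_subset hN hr hz
  have hzΩ : z ∈ Ω := hz (Metric.mem_ball_self (by linarith))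
  have h2r : 2 * r ≤ D := hwz ▸ Metric.dist_le_diam_of_mem hΩb hw hzΩ
  have hed : ENNReal.ofReal (2 * r) ≤ Metric.ediam Ω := by
    rw [← hwz, ← edist_dist]; exact Metric.edist_le_ediam_of_mem hw hzΩ
  have hVK := closedBall_two_mul_subset hr hz
  have hVΩ : Metric.ball z (2 * r) ⊆ Ω := Metric.ball_subset_closedBall.trans hVK
  have hrK : Metric.ball z r ⊆ Metric.closedBall z (2 * r) :=
    Metric.ball_subset_closedBall.trans (Metric.closedBall_subset_closedBall (by linarith))
  have hK := isCompact_closedBall z (2 * r)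
  have hcacc := hsol.integral_gradient_rpow_le hΩ hp hγ hν hcH hlam hA hB hfi hlui hu hχ hm hr hz
  have hm1 := setIntegral_abs_le_of_morreyNorm_le hfi hf1 hzΩ (by linarith) hed hVΩ
  have hm2 := setIntegral_abs_le_of_morreyNorm_le hlui hlu1 hzΩ (by linarith) hed hVΩ
  simp_rw [abs_of_nonneg (mul_nonneg hlam (le_max_right (u _) 0))] at hm2
  have hs1 : (2 * r) ^ ((N : ℝ) - N / q) ≤ D ^ ((N : ℝ) - N / q - b) * 2 ^ b * r ^ b := by
    rw [mul_assoc, ← Real.mul_rpow zero_le_two hr.le]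
    exact rpow_le_rpow_sub_mul_rpow (by linarith) h2r hb1
  have hs2 : (ν * (m + 1) * (L / r) / (cH / 2)) ^ g * volume.real (Metric.ball z (2 * r))
      ≤ G ^ g * (2 ^ N * V₁) * D ^ ((N : ℝ) - g - b) * r ^ b := by
    have e1 : ν * (m + 1) * (L / r) / (cH / 2) = G / r := by rw [hG]; field_simp
    have e2 : r ^ ((N : ℝ) - g) = r ^ N / r ^ g := by rw [Real.rpow_sub hr, Real.rpow_natCast]
    rw [e1, measureReal_def, Measure.addHaar_ball_of_pos _ _ (by linarith),
      finrank_euclideanSpace_fin, ENNReal.toReal_mul, ENNReal.toReal_ofReal (by positivity),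
      ← measureReal_def, Real.div_rpow hG0 hr.le]
    calc G ^ g / r ^ g * ((2 * r) ^ N * V₁) = G ^ g * (2 ^ N * V₁) * r ^ ((N : ℝ) - g) := by
          rw [e2]; ring
      _ ≤ G ^ g * (2 ^ N * V₁) * (D ^ ((N : ℝ) - g - b) * r ^ b) := by
          gcongr
          exact rpow_le_rpow_sub_mul_rpow hr (by linarith) hb2
      _ = _ := by ring
  refine integral_norm_le_of_integral_rpow_le hγ1 hr
    ((hu.memLpLoc_gradient.integrableOn hγ1 hK hVK).mono_set hrK) ?_ ?_
  · have := (hu.memLpLoc_gradient _ hK hVK).integrable_norm_rpow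
      (by simp; linarith) ENNReal.ofReal_ne_top
    rw [ENNReal.toReal_ofReal (by linarith)] at this
    exact IntegrableOn.mono_set this hrK
  · have hm1' := hm1.trans (mul_le_mul_of_nonneg_left hs1 M₁.2)
    have hm2' := hm2.trans (mul_le_mul_of_nonneg_left hs1 M₂.2)
    have hs2' := mul_le_mul_of_nonneg_left hs2 (by positivity : 0 ≤ cH / 2)
    have htot : cH / 2 * ∫ x in Metric.ball z r, ‖Du x‖ ^ γ ≤ cH / 2 * (C₁ * r ^ b) := by
      have e : cH / 2 * (C₁ * r ^ b) = M₂ * (D ^ ((N : ℝ) - N / q - b) * 2 ^ b * r ^ b)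
          + M₁ * (D ^ ((N : ℝ) - N / q - b) * 2 ^ b * r ^ b)
          + cH / 2 * (G ^ g * (2 ^ N * V₁) * D ^ ((N : ℝ) - g - b) * r ^ b) := by
        rw [hC₁]; field_simp
      rw [e]
      rw [mul_assoc] at hcacc
      exact hcacc.trans (add_le_add (add_le_add hm2' hm1') hs2')
    exact le_of_mul_le_mul_left htot (by positivity)

end

end GradientInequality

open GradientInequality in
theorem theorem3p1 (N : ℕ) (hN : 2 ≤ N) (p q γ ν cH : ℝ)
    (hp : 1 < p) (hγ : p < γ) (hq : 1 ≤ q) (hqγ : N / γ < q) (hν : 0 < ν) (hcH : 0 < cH)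
    (Ω : Set (Eucl N)) (hΩ : IsOpen Ω) (hΩb : Bornology.IsBounded Ω) (M₁ M₂ : ℝ≥0) :
    ∃ K : ℝ≥0, ∀ (A : Eucl N → ℝ → Eucl N → Eucl N) (B : Eucl N → ℝ → Eucl N → ℝ)
      (lam : ℝ) (f u : Eucl N → ℝ) (Du : Eucl N → Eucl N),
      IsCaratheodory Ω A → GrowthA p ν Ω A →
      0 ≤ lam → LowerBoundB γ cH lam f Ω B →
      MemMorrey 1 (N / q) Ω f → morreyNorm 1 (N / q) Ω f ≤ M₁ →
      MemMorrey 1 (N / q) Ω (fun x => lam * max (u x) 0) →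
      morreyNorm 1 (N / q) Ω (fun x => lam * max (u x) 0) ≤ M₂ →
      MemW1Loc γ Ω u Du → IsDistribSupersolution p Ω A B u Du →
      ∃ v : Eucl N → ℝ, v =ᵐ[volume.restrict Ω] u ∧
        IsLocallyHolder (holderExponent N p q γ) Ω v ∧
        ∀ (x₀ : Eucl N) (r : ℝ), Metric.ball x₀ r ⊆ Ω →
          ∀ x ∈ Metric.ball x₀ r, ∀ y ∈ Metric.ball x₀ r,
            |v x - v y| ≤ K * ‖x - y‖ ^ holderExponent N p q γ := by
  obtain ⟨C₀, hC₀, hgrowth⟩ := exists_hasMorreyGrowth hN hp hγ hq hν hcH hΩ hΩb M₁ M₂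
  have hα := holderExponent_pos hp hγ hq hqγ
  obtain ⟨C, hC, hrep⟩ := exists_holder_representative N hα
  refine ⟨⟨C * C₀, mul_nonneg hC hC₀⟩, fun A B lam f u Du _ hA hlam hB hf hf1 hlu hlu1 hu hsol => ?_⟩
  obtain ⟨v, hvu, hv⟩ := hrep C₀ Ω u Du hΩ
    (hgrowth A B lam f u Du hA hlam hB hf hf1 hlu hlu1 hu hsol)
  exact ⟨v, hvu, isLocallyHolder_of_ball hα (holderExponent_le_one hp hγ hq) hΩ hv, hv⟩
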